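/- **Notation.** For a matrix $A\in\mathbb R^{p\times p}$ let $\mathrm{vec}(A)$ be its column-stacked vectorization, $\|A\|_1,\|A\|_F,\|A\|_\infty$ the entrywise $\ell_1$, $\ell_2$ and maximum norms, $|||A|||_2$ the spectral norm, and $|||A|||_\infty$ the maximum absolute row sum (also for rectangular matrices). A real matrix is stable if all its eigenvalues have strictly negative real part. For stable $M^*$ and positive definite $C=DD^\top$, the Ornstein–Uhlenbeck process $dX(t)=M^*X(t)\,dt+D\,dW(t)$ has the unique equilibrium distribution $N(0,\Sigma^*)$, where $\Sigma^*$ is the unique solution of $M^*\Sigma+\Sigma (M^*)^\top+C=0$. Let $$A(\Sigma)=(\Sigma\otimes I_p)+(I_p\otimes\Sigma)K,\qquad \Gamma(\Sigma)=A(\Sigma)^\top A(\Sigma),\qquad \Gamma^*=\Gamma(\Sigma^*),$$ where $K$ is the commutation matrix, $K\,\mathrm{vec}(A)=\mathrm{vec}(A^\top)$. Given observations $X_1,\dots,X_n\in\mathbb R^p$ and $\lambda>0$, let $\hat\Sigma=\frac1n\sum_{i=1}^nX_iX_i^\top$; a Direct Lyapunov Lasso estimate $\hat M$ is a minimizer over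 $M\in\mathbb R^{p\times p}$ of $$\tfrac12\|M\hat\Sigma+\hat\Sigma M^\top+C\|_F^2+\lambda\|M\|_1 .$$ **Theorem.** There are universal constants $c_0,c_2,c_3>0$ such that the following holds for every $p\ge1$, every $n$ and every $c_1\ge c_0$. Let $X_1,\dots,X_n$ be i.i.d. draws from the Gaussian equilibrium distribution of the $p$-dimensional Ornstein–Uhlenbeck process defined by a stable drift matrix $M^*$ and a positive definite matrix $C$. Let $S=\{(j,k):M^*_{jk}\ne0\}$ and $d=|S|$. Assume that $\Gamma^*_{SS}$ is invertible and that $$|||\Gamma^*_{S^cS}(\Gamma^*_{SS})^{-1}|||_\infty<1-\alpha$$ for some $\alpha\in(0,1]$. Put $c_{\Gamma^*}=|||(\Gamma^*_{SS})^{-1}|||_\infty$, $c_{M^*}=\|M^*\|_\infty$, $c_{\Sigma^*}=|||\Sigma^*|||_2$, $c_C=\|C\|_F$, $c_*=\frac6\alpha c_{\Gamma^*}$ and $$\tilde c=\max\Big\{\tfrac{4\max\{1,c_{\Sigma^*}^2\}(4+8c_{\Sigma^*})^2}{c_3},\ 16c_1^2c_{\Sigma^*}^2(4+8c_{\Sigma^*})^2,\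 \tfrac{16\max\{1,c_{\Sigma^*}^2\}c_C^2}{c_3},\ 64c_1^2c_{\Sigma^*}^2c_C^2\Big\}.$$ Suppose that, for some $\tau_1>1$, $$n>\tau_1\tilde c\,d\,p\,\max\{c_*^2,\tfrac14\}\qquad\text{and}\qquad \lambda>\frac{3c_{M^*}(2-\alpha)}{\alpha}\sqrt{\frac{\tau_1\tilde c\,d\,p}{n}} .$$ Then, with probability at least $1-c_2e^{-\tau_1p}$, the following statements hold. a) The minimizer $\hat M$ exists and is unique, its support $\hat S=\{(j,k):\hat M_{jk}\neq0\}$ is contained in $S$, and $\|\hat M-M^*\|_\infty<\frac{2c_{\Gamma^*}}{2-\alpha}\lambda$. b) If moreover $\min_{(j,k)\in S}|M^*_{jk}|>\frac{2c_{\Gamma^*}}{2-\alpha}\lambda$, then $\hat S=S$ and $\mathrm{sign}(\hat M_{jk})=\mathrm{sign}(M^*_{jk})$ for all $(j,k)\in S$. -/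

import Mathlib

open MeasureTheory ProbabilityTheory
open scoped Kronecker Matrix

namespace LyapunovLasso

noncomputable section

/-! ### Norms of vectors and matrices -/

/-- The entrywise norm `‖A‖_1 = ‖vec A‖_1`. -/
def l1Norm {p : ℕ} (A : Matrix (Fin p) (Fin p) ℝ) : ℝ := ∑ q, |A.vec q|

/-- The Frobenius norm `‖A‖_F = ‖vec A‖_2`. -/
def frobNorm {p : ℕ} (A : Matrix (Fin p) (Fin p) ℝ) : ℝ := ‖WithLp.toLp 2 A.vec‖

/-- The entrywise maximum norm `‖A‖_∞ = ‖vec A‖_∞`. -/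
def maxNorm {p : ℕ} (A : Matrix (Fin p) (Fin p) ℝ) : ℝ := ‖A.vec‖

open scoped Matrix.Norms.L2Operator in
/-- The spectral norm `|||A|||_2`. -/
def spectralNorm {p : ℕ} (A : Matrix (Fin p) (Fin p) ℝ) : ℝ := ‖A‖

open scoped Matrix.Norms.Operator in
/-- The maximum absolute row sum `|||A|||_∞ = max_i ∑_j |a_ij|`, for a rectangular matrix. -/
def rowSumNorm {m n : Type*} [Fintype m] [Fintype n] (A : Matrix m n ℝ) : ℝ := ‖A‖

/-! ### The Ornstein–Uhlenbeck process and its equilibrium -/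

/-- A real square matrix is stable if all its complex eigenvalues have negative real part. -/
def IsStable {p : ℕ} (M : Matrix (Fin p) (Fin p) ℝ) : Prop :=
  ∀ z ∈ spectrum ℂ (M.map (algebraMap ℝ ℂ)), z.re < 0

/-- `∫_0^t e^{sM} C e^{sMᵀ} ds`, the covariance matrix of `∫_0^t e^{(t-s)M} D dW(s)` when
`C = D Dᵀ`. -/
def ouCov {p : ℕ} (M C : Matrix (Fin p) (Fin p) ℝ) (t : ℝ) : Matrix (Fin p) (Fin p) ℝ :=
  Matrix.of fun i j =>
    ∫ s in (0 : ℝ)..t, (NormedSpace.exp (s • M) * C * (NormedSpace.exp (s • M))ᵀ) i j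

open scoped MatrixOrder in
/-- The transition kernel in time `t` of the Ornstein–Uhlenbeck process
`dX(t) = M X(t) dt + D dW(t)` with `C = D Dᵀ`: started at `x`, the law of
`X(t) = e^{tM} x + ∫_0^t e^{(t-s)M} D dW(s)` is `N(e^{tM} x, ∫_0^t e^{sM} C e^{sMᵀ} ds)`. -/
def ouKernel {p : ℕ} (M C : Matrix (Fin p) (Fin p) ℝ) (t : ℝ) :
    Kernel (EuclideanSpace ℝ (Fin p)) (EuclideanSpace ℝ (Fin p)) where
  toFun x := multivariateGaussian
    (Matrix.toEuclideanCLM (𝕜 := ℝ) (NormedSpace.exp (t • M)) x) (ouCov M C t)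
  measurable' := by
    refine Measure.measurable_of_measurable_coe _ fun B hB => ?_
    have hm : Measurable (fun y : EuclideanSpace ℝ (Fin p) × EuclideanSpace ℝ (Fin p) =>
        Matrix.toEuclideanCLM (𝕜 := ℝ) (NormedSpace.exp (t • M)) y.1 +
          Matrix.toEuclideanCLM (𝕜 := ℝ) (CFC.sqrt (ouCov M C t)) y.2) := by fun_prop
    have h := measurable_measure_prodMk_left
      (ν := stdGaussian (EuclideanSpace ℝ (Fin p))) (hm hB)
    refine (congrArg Measurable (funext fun x => ?_)).mpr h
    rw [multivariateGaussian, Measure.map_apply (by fun_prop) hB]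
    rfl

/-- `ν` is an equilibrium (stationary) distribution of the Ornstein–Uhlenbeck process with drift
matrix `M` and volatility matrix `C`. -/
def IsOUEquilibrium {p : ℕ} (M C : Matrix (Fin p) (Fin p) ℝ)
    (ν : Measure (EuclideanSpace ℝ (Fin p))) : Prop :=
  IsProbabilityMeasure ν ∧ ∀ t : ℝ, 0 ≤ t → (ouKernel M C t).Invariant ν

/-! ### The Gram matrix -/

/-- The commutation matrix `K`, with `K vec(A) = vec(Aᵀ)`. -/
def commMatrix (p : ℕ) : Matrix (Fin p × Fin p) (Fin p × Fin p) ℝ :=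
  Matrix.of fun a b => if a = b.swap then 1 else 0

/-- `A(S) = (S ⊗ I) + (I ⊗ S) K`, the matrix of `vec(M) ↦ vec(M S + S Mᵀ)` for symmetric `S`. -/
def lyapMatrix {p : ℕ} (S : Matrix (Fin p) (Fin p) ℝ) :
    Matrix (Fin p × Fin p) (Fin p × Fin p) ℝ :=
  (S ⊗ₖ (1 : Matrix (Fin p) (Fin p) ℝ)) + ((1 : Matrix (Fin p) (Fin p) ℝ) ⊗ₖ S) * commMatrix p

/-- The Gram matrix `Γ(S) = A(S)ᵀ A(S)`. -/
def gram {p : ℕ} (S : Matrix (Fin p) (Fin p) ℝ) : Matrix (Fin p × Fin p) (Fin p × Fin p) ℝ :=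
  (lyapMatrix S)ᵀ * lyapMatrix S

/-- The support of a matrix, as a set of indices of `vec M`: the coordinate `(k, j)` of `vec M` is
the entry `M j k`. -/
def vecSupport {p : ℕ} (M : Matrix (Fin p) (Fin p) ℝ) : Finset (Fin p × Fin p) :=
  Finset.univ.filter fun q => M.vec q ≠ 0

/-- The block `G_{SS}`. -/
def blockSS {p : ℕ} (G : Matrix (Fin p × Fin p) (Fin p × Fin p) ℝ)
    (S : Finset (Fin p × Fin p)) : Matrix {q // q ∈ S} {q // q ∈ S} ℝ :=
  G.submatrix Subtype.val Subtype.val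

/-- The block `G_{SᶜS}`. -/
def blockScS {p : ℕ} (G : Matrix (Fin p × Fin p) (Fin p × Fin p) ℝ)
    (S : Finset (Fin p × Fin p)) : Matrix {q // q ∉ S} {q // q ∈ S} ℝ :=
  G.submatrix Subtype.val Subtype.val

/-! ### The Direct Lyapunov Lasso -/

/-- The sample covariance matrix `(1/n) ∑ x_i x_iᵀ` of centered observations. -/
def sampleCov {p n : ℕ} (x : Fin n → EuclideanSpace ℝ (Fin p)) : Matrix (Fin p) (Fin p) ℝ :=
  (1 / (n : ℝ)) • ∑ i, Matrix.vecMulVec (x i).ofLp (x i).ofLp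

/-- The objective `½ ‖M S + S Mᵀ + C‖_F² + lam ‖M‖_1`. -/
def objective {p : ℕ} (S C : Matrix (Fin p) (Fin p) ℝ) (lam : ℝ)
    (M : Matrix (Fin p) (Fin p) ℝ) : ℝ :=
  1 / 2 * frobNorm (M * S + S * Mᵀ + C) ^ 2 + lam * l1Norm M

/-- `M` is a solution of the Direct Lyapunov Lasso problem. -/
def IsMinimizer {p : ℕ} (S C : Matrix (Fin p) (Fin p) ℝ) (lam : ℝ)
    (M : Matrix (Fin p) (Fin p) ℝ) : Prop :=
  ∀ N : Matrix (Fin p) (Fin p) ℝ, objective S C lam M ≤ objective S C lam N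

/-! ### The constants -/

/-- `c_Γ = |||(Γ(S)_{SS})⁻¹|||_∞`, the support being that of the drift matrix `M`. -/
def cGamma {p : ℕ} (M S : Matrix (Fin p) (Fin p) ℝ) : ℝ :=
  rowSumNorm (blockSS (gram S) (vecSupport M))⁻¹

/-- The constant `c̃`, in terms of `c₁`, `c₃`, `c_Σ` and `c_C`. -/
def cTilde (c₁ c₃ cSig cC : ℝ) : ℝ :=
  max (max (4 * max 1 (cSig ^ 2) * (4 + 8 * cSig) ^ 2 / c₃)
        (16 * c₁ ^ 2 * cSig ^ 2 * (4 + 8 * cSig) ^ 2))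
    (max (16 * max 1 (cSig ^ 2) * cC ^ 2 / c₃)
        (64 * c₁ ^ 2 * cSig ^ 2 * cC ^ 2))

end

end LyapunovLasso

/-! The argument is a primal-dual witness construction made deterministic, plus one concentration
event. Since `C.vec` equals `-(lyapMatrix Sig *ᵥ M.vec)`, the objective is an ordinary lasso in
`M.vec` with Gram matrix `gram T`, where `T` is the sample covariance, and its smooth part has
gradient `A(T)ᵀ A(T - Sig) vec M` at the true drift. Hence both the Gram error and the gradient
noise are linear in `T - Sig`.

Minimize over matrices supported on `S`. Restricted optimality bounds the gradient on `S` by `lam`;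
invertibility of the population block turns this into a bound on the error (`witness_bounds`), and
irrepresentability transfers it to a gradient strictly below `lam` off `S`. The restricted minimizer
is then the unique global one (`lassoObj_le_of_kkt`). All that is required is `√d * δ * (4 + 8‖Sig‖)
≤ eps` for `δ` bounding the spectral norm of `T - Sig`. Testing rows of the Gram error against sign
vectors, of Euclidean norm at most `√d`, keeps the loss at `√d` instead of `d`
(`sum_abs_gram_sub_le`).

For the probability, stability gives `exp (k M) → 0`, so letting the time go to infinity in the
stationarity equation identifies the equilibrium as `N(0, Sig)`. Chernoff bounds for squares of its
Gaussian projections, over a `1/2`-net of the sphere, then control `T - Sig`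
(`exists_event_sampleCov`). -/

namespace LyapunovLasso

/-! ### Lasso optimality conditions for a general design matrix. -/

section Lasso

variable {m ι : Type*} [Fintype m] [Fintype ι]

/-- The Lasso objective `½ ‖A x + c‖² + lam ‖x‖₁` of a vector `x`. -/
noncomputable def lassoObj (A : Matrix m ι ℝ) (c : m → ℝ) (lam : ℝ) (x : ι → ℝ) : ℝ :=
  1 / 2 * ((A *ᵥ x + c) ⬝ᵥ (A *ᵥ x + c)) + lam * ∑ q, |x q|

/-- The gradient of `½ ‖A x + c‖²`. -/
def lassoGrad (A : Matrix m ι ℝ) (c : m → ℝ) (x : ι → ℝ) : ι → ℝ := Aᵀ *ᵥ (A *ᵥ x + c)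

lemma lassoGrad_dotProduct (A : Matrix m ι ℝ) (c : m → ℝ) (x h : ι → ℝ) :
    lassoGrad A c x ⬝ᵥ h = (A *ᵥ x + c) ⬝ᵥ (A *ᵥ h) := by
  rw [lassoGrad, Matrix.mulVec_transpose, ← Matrix.dotProduct_mulVec]

lemma lassoObj_add (A : Matrix m ι ℝ) (c : m → ℝ) (lam : ℝ) (x h : ι → ℝ) :
    lassoObj A c lam (x + h) = lassoObj A c lam x + 1 / 2 * ((A *ᵥ h) ⬝ᵥ (A *ᵥ h))
      + lassoGrad A c x ⬝ᵥ h + lam * ∑ q, (|x q + h q| - |x q|) := by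
  have h1 : A *ᵥ (x + h) + c = (A *ᵥ x + c) + A *ᵥ h := by
    rw [Matrix.mulVec_add]; abel
  rw [lassoGrad_dotProduct, lassoObj, lassoObj, h1]
  generalize A *ᵥ x + c = u
  rw [add_dotProduct, dotProduct_add, dotProduct_add, dotProduct_comm (A *ᵥ h) u,
    Finset.sum_sub_distrib]
  simp only [Pi.add_apply]
  ring

lemma lassoGrad_sub (A : Matrix m ι ℝ) (c : m → ℝ) (x y : ι → ℝ) :
    lassoGrad A c x = (Aᵀ * A) *ᵥ (x - y) + lassoGrad A c y := by
  rw [lassoGrad, lassoGrad, ← Matrix.mulVec_mulVec, ← Matrix.mulVec_add, Matrix.mulVec_sub]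
  congr 1
  abel

lemma continuous_lassoObj (A : Matrix m ι ℝ) (c : m → ℝ) (lam : ℝ) :
    Continuous (lassoObj A c lam) := by
  unfold lassoObj
  fun_prop

lemma norm_le_lassoObj (A : Matrix m ι ℝ) (c : m → ℝ) {lam : ℝ} (hlam : 0 ≤ lam) (x : ι → ℝ) :
    lam * ‖x‖ ≤ lassoObj A c lam x := by
  have h1 : ‖x‖ ≤ ∑ q, |x q| := by
    refine (pi_norm_le_iff_of_nonneg (Finset.sum_nonneg fun _ _ => abs_nonneg _)).2 fun q => ?_
    exact Finset.single_le_sum (f := fun q => |x q|) (fun _ _ => abs_nonneg _) (Finset.mem_univ q)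
  have h2 : 0 ≤ (A *ᵥ x + c) ⬝ᵥ (A *ᵥ x + c) :=
    Finset.sum_nonneg fun _ _ => mul_self_nonneg _
  have := mul_le_mul_of_nonneg_left h1 hlam
  unfold lassoObj
  linarith

lemma exists_minimizer_of_support (A : Matrix m ι ℝ) (c : m → ℝ) {lam : ℝ} (hlam : 0 < lam)
    (S : Finset ι) :
    ∃ x : ι → ℝ, (∀ q, q ∉ S → x q = 0) ∧
      ∀ y : ι → ℝ, (∀ q, q ∉ S → y q = 0) → lassoObj A c lam x ≤ lassoObj A c lam y := by
  have hcl : IsClosed {x : ι → ℝ | ∀ q, q ∉ S → x q = 0} := by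
    simp only [Set.ofPred_forall]
    exact isClosed_iInter fun q => isClosed_iInter fun _ =>
      isClosed_eq (continuous_apply q) continuous_const
  have htop : Filter.Tendsto (lassoObj A c lam) (Filter.cocompact _) Filter.atTop :=
    Filter.tendsto_atTop_mono (norm_le_lassoObj A c hlam.le)
      ((tendsto_norm_cocompact_atTop).const_mul_atTop hlam)
  obtain ⟨x, hx, hmin⟩ := (continuous_lassoObj A c lam).continuousOn.exists_isMinOn' hcl
    (x₀ := 0) (by simp)
    ((htop.eventually (Filter.eventually_ge_atTop (lassoObj A c lam 0))).filter_mono inf_le_left)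
  exact ⟨x, hx, fun y hy => hmin hy⟩

/-- Divide by `s` and let `s` tend to `0`: this extracts first-order conditions from one-sided
perturbations without differentiating the absolute value. -/
lemma nonneg_of_forall_small {a b : ℝ} (h : ∀ s : ℝ, 0 < s → s < 1 → 0 ≤ s * a + s ^ 2 * b) :
    0 ≤ a := by
  by_contra! ha
  have hb : 0 < |b| + 1 := by positivity
  set s := min (1 / 2) (-a / (2 * (|b| + 1))) with hs
  have hs0 : 0 < s := lt_min (by norm_num) (div_pos (by linarith) (by positivity))
  have hs1 : s < 1 := lt_of_le_of_lt (min_le_left _ _) (by norm_num)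
  have hs2 : s * (2 * (|b| + 1)) ≤ -a := (le_div_iff₀ (by positivity)).1 (min_le_right _ _)
  have h1 := h s hs0 hs1
  have h2 : 0 ≤ a + s * b := by
    by_contra! h3
    have := mul_neg_of_pos_of_neg hs0 h3
    nlinarith
  have h4 : s * b ≤ s * (|b| + 1) :=
    mul_le_mul_of_nonneg_left (by linarith [le_abs_self b]) hs0.le
  nlinarith

variable [DecidableEq ι]

/-- The optimality conditions on the allowed support. -/
lemma kkt_of_minimizer (A : Matrix m ι ℝ) (c : m → ℝ) {lam : ℝ} (hlam : 0 ≤ lam) (S : Finset ι)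
    {x : ι → ℝ} (hx : ∀ q, q ∉ S → x q = 0)
    (hmin : ∀ y : ι → ℝ, (∀ q, q ∉ S → y q = 0) → lassoObj A c lam x ≤ lassoObj A c lam y)
    {q : ι} (hq : q ∈ S) :
    |lassoGrad A c x q| ≤ lam ∧ lam * |x q| ≤ -(lassoGrad A c x q * x q) := by
  have key : ∀ t : ℝ, 0 ≤ 1 / 2 * t ^ 2 * ((A *ᵥ Pi.single q 1) ⬝ᵥ (A *ᵥ Pi.single q 1))
      + lassoGrad A c x q * t + lam * (|x q + t| - |x q|) := by
    intro t
    have h1 := hmin (x + Pi.single q t) (by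
      intro r hr
      have : r ≠ q := fun h => hr (h ▸ hq)
      simp [this, hx r hr])
    have h2 : (Pi.single q t : ι → ℝ) = t • Pi.single q 1 := by
      ext r; by_cases hr : r = q
      · subst hr; simp
      · simp [hr]
    have h3 : ∑ r, (|x r + (Pi.single q t : ι → ℝ) r| - |x r|) = |x q + t| - |x q| := by
      rw [Finset.sum_eq_single q]
      · simp
      · intro r _ hr; simp [hr]
      · simp
    rw [lassoObj_add, h3, dotProduct_single, h2, Matrix.mulVec_smul, smul_dotProduct,
      dotProduct_smul, smul_eq_mul, smul_eq_mul] at h1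
    nlinarith
  set a := (A *ᵥ Pi.single q 1) ⬝ᵥ (A *ᵥ Pi.single q 1)
  set g := lassoGrad A c x q
  have hle : ∀ s : ℝ, lam * (|x q + s| - |x q|) ≤ lam * |s| := fun s =>
    mul_le_mul_of_nonneg_left (by linarith [abs_add_le (x q) s]) hlam
  refine ⟨abs_le.2 ⟨?_, ?_⟩, ?_⟩
  · suffices 0 ≤ g + lam by linarith
    refine nonneg_of_forall_small (b := a / 2) fun s hs _ => ?_
    have h1 := key s
    have h2 := hle s
    rw [abs_of_pos hs] at h2
    linarith
  · suffices 0 ≤ lam - g by linarith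
    refine nonneg_of_forall_small (b := a / 2) fun s hs _ => ?_
    have h1 := key (-s)
    have h2 := hle (-s)
    rw [abs_neg, abs_of_pos hs] at h2
    linarith
  · suffices 0 ≤ -(g * x q) - lam * |x q| by linarith
    refine nonneg_of_forall_small (b := a / 2 * x q ^ 2) fun s hs hs1 => ?_
    -- Shrinking the coordinate towards `0` keeps its sign, so the penalty is exactly linear in `s`.
    -- With `|g| ≤ lam` the result says `g = -lam * sign (x q)` when `x q ≠ 0`.
    have h1 := key (-(s * x q))
    have h2 : |x q + -(s * x q)| = (1 - s) * |x q| := by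
      rw [show x q + -(s * x q) = (1 - s) * x q by ring, abs_mul, abs_of_pos (by linarith)]
    rw [h2] at h1
    linarith

/-- A point satisfying the optimality conditions strictly off the support is the unique
minimizer. -/
lemma lassoObj_le_of_kkt (A : Matrix m ι ℝ) (c : m → ℝ) (lam : ℝ) (S : Finset ι)
    {x : ι → ℝ} (hx : ∀ q, q ∉ S → x q = 0)
    (hS : ∀ q ∈ S, |lassoGrad A c x q| ≤ lam ∧ lam * |x q| ≤ -(lassoGrad A c x q * x q))
    (hSc : ∀ q, q ∉ S → |lassoGrad A c x q| < lam)
    (hinj : ∀ h : ι → ℝ, (∀ q, q ∉ S → h q = 0) → A *ᵥ h = 0 → h = 0) (y : ι → ℝ) :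
    lassoObj A c lam x ≤ lassoObj A c lam y ∧
      (lassoObj A c lam y ≤ lassoObj A c lam x → y = x) := by
  set g := lassoGrad A c x with hg
  obtain ⟨h, rfl⟩ : ∃ h, y = x + h := ⟨y - x, by abel⟩
  -- Coordinatewise subgradient inequality: `-g q` is a subgradient of `lam * |·|` at `x q`. The
  -- increment of the objective is the sum of these terms and half of `‖A h‖²`.
  have hterm : ∀ q, 0 ≤ g q * h q + lam * (|x q + h q| - |x q|) := by
    intro q
    have h1 : -(g q * (x q + h q)) ≤ |g q| * |x q + h q| := by
      rw [← abs_mul]; exact neg_le_abs _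
    by_cases hq : q ∈ S
    · have h2 := mul_le_mul_of_nonneg_right (hS q hq).1 (abs_nonneg (x q + h q))
      have h3 := (hS q hq).2
      nlinarith
    · have h2 := mul_le_mul_of_nonneg_right (hSc q hq).le (abs_nonneg (x q + h q))
      have h3 := hx q hq
      rw [h3] at h1 h2 ⊢
      simp at h1 h2 ⊢
      nlinarith
  have hA : 0 ≤ (A *ᵥ h) ⬝ᵥ (A *ᵥ h) := Finset.sum_nonneg fun _ _ => mul_self_nonneg _
  have hsum : g ⬝ᵥ h + lam * ∑ q, (|x q + h q| - |x q|)
      = ∑ q, (g q * h q + lam * (|x q + h q| - |x q|)) := by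
    rw [Finset.mul_sum, dotProduct, Finset.sum_add_distrib]
  have hsum0 := Finset.sum_nonneg fun q (_ : q ∈ Finset.univ) => hterm q
  rw [lassoObj_add, ← hg]
  refine ⟨by linarith, fun hle => ?_⟩
  have hAz : (A *ᵥ h) ⬝ᵥ (A *ᵥ h) = 0 := by linarith
  have hz : ∑ q, (g q * h q + lam * (|x q + h q| - |x q|)) = 0 := by linarith
  rw [Finset.sum_eq_zero_iff_of_nonneg fun q _ => hterm q] at hz
  -- In a tie every nonnegative term vanishes: strictness off `S` forces `h` to be supported on `S`,
  -- and there `A h = 0` gives `h = 0`.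
  have hh : h = 0 := by
    refine hinj h (fun q hq => ?_) (dotProduct_self_eq_zero.1 hAz)
    have h1 := hz q (Finset.mem_univ q)
    rw [hx q hq] at h1
    simp only [zero_add, abs_zero, sub_zero] at h1
    by_contra hne
    have h2 := mul_lt_mul_of_pos_right (hSc q hq) (abs_pos.2 hne)
    have h3 : -(g q * h q) ≤ |g q| * |h q| := by
      rw [← abs_mul]; exact neg_le_abs _
    linarith
  rw [hh, add_zero]

lemma norm_mulVec_le_rowSumNorm {m' n' : Type*} [Fintype m'] [Fintype n'] (A : Matrix m' n' ℝ)
    (v : n' → ℝ) : ‖A *ᵥ v‖ ≤ rowSumNorm A * ‖v‖ :=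
  Matrix.linfty_opNorm_mulVec A v

lemma rowSumNorm_nonneg {m' n' : Type*} [Fintype m'] [Fintype n'] (A : Matrix m' n' ℝ) :
    0 ≤ rowSumNorm A := by
  open scoped Matrix.Norms.Operator in exact norm_nonneg A

lemma rowSumNorm_pos {m' n' : Type*} [Fintype m'] [Fintype n'] {A : Matrix m' n' ℝ}
    (hA : A ≠ 0) : 0 < rowSumNorm A := by
  open scoped Matrix.Norms.Operator in exact norm_pos_iff.2 hA

end Lasso

/-! ### Primal-dual witness under a perturbed Gram matrix. -/

section Witness

variable {p : ℕ}

/-- The multiplication of a block with a vector supported on `S`. -/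
lemma sum_subtype_eq_mulVec (G : Matrix (Fin p × Fin p) (Fin p × Fin p) ℝ)
    (S : Finset (Fin p × Fin p)) {u : Fin p × Fin p → ℝ} (hu : ∀ q, q ∉ S → u q = 0)
    (a : Fin p × Fin p) : ∑ q : {q // q ∈ S}, G a q * u q = (G *ᵥ u) a := by
  rw [Finset.sum_coe_sort S (fun q => G a q * u q), Matrix.mulVec, dotProduct]
  exact Finset.sum_subset (Finset.subset_univ S) fun q _ hq => by rw [hu q hq, mul_zero]

lemma norm_comp_subtype {S : Finset (Fin p × Fin p)} {u : Fin p × Fin p → ℝ}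
    (hu : ∀ q, q ∉ S → u q = 0) : ‖fun q : {q // q ∈ S} => u q‖ = ‖u‖ := by
  refine le_antisymm ((pi_norm_le_iff_of_nonneg (norm_nonneg _)).2 fun q => norm_le_pi_norm u q) ?_
  refine (pi_norm_le_iff_of_nonneg (norm_nonneg _)).2 fun q => ?_
  by_cases hq : q ∈ S
  · exact norm_le_pi_norm (fun q : {q // q ∈ S} => u q) ⟨q, hq⟩
  · rw [hu q hq, norm_zero]; exact norm_nonneg _

lemma abs_mulVec_le_of_rowSum (D : Matrix (Fin p × Fin p) (Fin p × Fin p) ℝ)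
    (S : Finset (Fin p × Fin p)) {u : Fin p × Fin p → ℝ} (hu : ∀ q, q ∉ S → u q = 0)
    {a : Fin p × Fin p} {eps : ℝ} (hD : ∑ q ∈ S, |D a q| ≤ eps) :
    |(D *ᵥ u) a| ≤ eps * ‖u‖ := by
  rw [← sum_subtype_eq_mulVec D S hu, Finset.sum_coe_sort S (fun q => D a q * u q)]
  calc _ ≤ ∑ q ∈ S, |D a q * u q| := Finset.abs_sum_le_sum_abs _ _
    _ ≤ ∑ q ∈ S, |D a q| * ‖u‖ := Finset.sum_le_sum fun q _ => by
        rw [abs_mul]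
        exact mul_le_mul_of_nonneg_left (norm_le_pi_norm u q) (abs_nonneg _)
    _ ≤ _ := by rw [← Finset.sum_mul]; exact mul_le_mul_of_nonneg_right hD (norm_nonneg _)

variable {G H : Matrix (Fin p × Fin p) (Fin p × Fin p) ℝ} {S : Finset (Fin p × Fin p)} {eps : ℝ}

/-- A vector supported on `S` is controlled by its image under a perturbation of `G`. -/
lemma norm_le_of_blockSS (hG : IsUnit (blockSS G S)) (hD : ∀ a, ∑ q ∈ S, |(H - G) a q| ≤ eps)
    {u : Fin p × Fin p → ℝ} (hu : ∀ q, q ∉ S → u q = 0) {b : ℝ} (hb : 0 ≤ b)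
    (hbu : ∀ q ∈ S, |(H *ᵥ u) q| ≤ b) (heps : 0 ≤ eps) :
    ‖u‖ ≤ rowSumNorm (blockSS G S)⁻¹ * (b + eps * ‖u‖) ∧
    ‖blockSS G S *ᵥ fun q : {q // q ∈ S} => u q‖ ≤ b + eps * ‖u‖ := by
  have hle : ‖blockSS G S *ᵥ fun q : {q // q ∈ S} => u q‖ ≤ b + eps * ‖u‖ := by
    refine (pi_norm_le_iff_of_nonneg (by positivity)).2 fun a => ?_
    have h1 : (blockSS G S *ᵥ fun q : {q // q ∈ S} => u q) a = (G *ᵥ u) a :=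
      sum_subtype_eq_mulVec G S hu a
    have h2 : (G *ᵥ u) a = (H *ᵥ u) a - ((H - G) *ᵥ u) a := by
      rw [Matrix.sub_mulVec]; simp
    rw [h1, h2, Real.norm_eq_abs]
    exact (abs_sub _ _).trans (add_le_add (hbu a a.2) (abs_mulVec_le_of_rowSum _ S hu (hD a)))
  refine ⟨?_, hle⟩
  have hinv : (blockSS G S)⁻¹ *ᵥ (blockSS G S *ᵥ fun q : {q // q ∈ S} => u q)
      = fun q : {q // q ∈ S} => u q := by
    rw [Matrix.mulVec_mulVec, Matrix.nonsing_inv_mul _ ((Matrix.isUnit_iff_isUnit_det _).1 hG),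
      Matrix.one_mulVec]
  rw [← norm_comp_subtype hu]
  conv_lhs => rw [← hinv]
  rw [norm_comp_subtype hu]
  exact (norm_mulVec_le_rowSumNorm _ _).trans
    (mul_le_mul_of_nonneg_left hle (rowSumNorm_nonneg _))

/-- Injectivity on vectors supported on `S` survives the perturbation, because `‖u‖` is at most a
factor below `1` times itself. This yields uniqueness for the sample problem. -/
lemma eq_zero_of_mulVec_eq_zero (hG : IsUnit (blockSS G S))
    (hD : ∀ a, ∑ q ∈ S, |(H - G) a q| ≤ eps) (heps : 0 ≤ eps)
    (hsmall : rowSumNorm (blockSS G S)⁻¹ * eps < 1)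
    {u : Fin p × Fin p → ℝ} (hu : ∀ q, q ∉ S → u q = 0) (h0 : H *ᵥ u = 0) : u = 0 := by
  have h1 := (norm_le_of_blockSS hG hD hu le_rfl (by simp [h0]) heps).1
  rw [zero_add, ← mul_assoc] at h1
  by_contra hne
  have h2 := norm_pos_iff.2 hne
  nlinarith

/-- The primal-dual witness bounds. -/
lemma witness_bounds (hG : IsUnit (blockSS G S)) (hS : S.Nonempty)
    {α : ℝ} (hα : 0 < α) (hα1 : α ≤ 1)
    (hirr : rowSumNorm (blockScS G S * (blockSS G S)⁻¹) < 1 - α)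
    (hD : ∀ a, ∑ q ∈ S, |(H - G) a q| ≤ eps) (heps : 0 ≤ eps)
    (hsmall : rowSumNorm (blockSS G S)⁻¹ * eps < α / 6)
    {u g r : Fin p × Fin p → ℝ} (hu : ∀ q, q ∉ S → u q = 0) (hg : g = H *ᵥ u + r)
    {lam rho : ℝ} (hgS : ∀ q ∈ S, |g q| ≤ lam) (hr : ∀ q, |r q| ≤ rho)
    (hrho : 3 * (2 - α) * rho < α * lam) :
    ‖u‖ < 2 * rowSumNorm (blockSS G S)⁻¹ / (2 - α) * lam ∧ ∀ q, q ∉ S → |g q| < lam := by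
  obtain ⟨q0, hq0⟩ := hS
  have hrho0 : 0 ≤ rho := (abs_nonneg _).trans (hr q0)
  have hlam : 0 < lam := by
    by_contra! h
    nlinarith
  set cG := rowSumNorm (blockSS G S)⁻¹ with hcG
  -- Strict positivity is what makes the final error bound strict; it rests on `S` being nonempty.
  have hcGpos : 0 < cG := by
    refine rowSumNorm_pos fun h => ?_
    have h1 := Matrix.nonsing_inv_mul _ ((Matrix.isUnit_iff_isUnit_det _).1 hG)
    rw [h, zero_mul] at h1
    have := congrFun (congrFun h1 ⟨q0, hq0⟩) ⟨q0, hq0⟩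
    simp at this
  set U := ‖u‖ with hU
  have hU0 : 0 ≤ U := norm_nonneg u
  have hHu : ∀ q, (H *ᵥ u) q = g q - r q := fun q => by simp [hg]
  obtain ⟨h1, h2⟩ := norm_le_of_blockSS (b := lam + rho) hG hD hu (by linarith)
    (fun q hq => by
      rw [hHu]
      exact (abs_sub _ _).trans (add_le_add (hgS q hq) (hr q))) heps
  rw [← hU, ← hcG] at h1
  rw [← hU] at h2
  have h2α : 0 < 2 - α := by linarith
  -- The term `cG * eps * U` is below `α / 6 * U` and is absorbed on the left.
  have hUb : U * (6 - α) ≤ 6 * cG * (lam + rho) := by nlinarith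
  constructor
  · rw [div_mul_eq_mul_div, lt_div_iff₀ h2α]
    have h3 : cG * (3 * (2 - α) * rho) < cG * (α * lam) := mul_lt_mul_of_pos_left hrho hcGpos
    have h4 : U * (6 - α) * (2 - α) ≤ 6 * cG * (lam + rho) * (2 - α) :=
      mul_le_mul_of_nonneg_right hUb h2α.le
    have h5 : 0 < cG * lam := by positivity
    -- The noise condition gives `3(2 - α)(lam + rho) < (6 - 2α) lam`, and `6 - 2α` is smaller than
    -- `6 - α`.
    have h6 : U * (2 - α) * (6 - α) < 2 * cG * lam * (6 - α) := by nlinarith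
    exact lt_of_mul_lt_mul_right h6 (by linarith)
  · intro a ha
    have h3 : (blockScS G S *ᵥ fun q : {q // q ∈ S} => u q) ⟨a, ha⟩ = (G *ᵥ u) a :=
      sum_subtype_eq_mulVec G S hu a
    have h4 : blockScS G S *ᵥ (fun q : {q // q ∈ S} => u q)
        = (blockScS G S * (blockSS G S)⁻¹) *ᵥ (blockSS G S *ᵥ fun q : {q // q ∈ S} => u q) := by
      rw [Matrix.mulVec_mulVec, Matrix.mul_assoc,
        Matrix.nonsing_inv_mul _ ((Matrix.isUnit_iff_isUnit_det _).1 hG), Matrix.mul_one]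
    have hE : 0 ≤ lam + rho + eps * U := by positivity
    have h5 : |(G *ᵥ u) a| ≤ (1 - α) * (lam + rho + eps * U) := by
      rw [← h3, h4]
      refine (norm_le_pi_norm ((blockScS G S * (blockSS G S)⁻¹) *ᵥ
        (blockSS G S *ᵥ fun q : {q // q ∈ S} => u q)) ⟨a, ha⟩).trans ?_
      refine (norm_mulVec_le_rowSumNorm _ _).trans ?_
      exact mul_le_mul hirr.le h2 (norm_nonneg _) (by linarith)
    have h6 : |((H - G) *ᵥ u) a| ≤ eps * U := abs_mulVec_le_of_rowSum _ S hu (hD a)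
    have h7 : g a = (G *ᵥ u) a + ((H - G) *ᵥ u) a + r a := by
      rw [hg, Matrix.sub_mulVec]; simp
    have h8 : |g a| ≤ (1 - α) * (lam + rho + eps * U) + eps * U + rho := by
      rw [h7]
      exact (abs_add_three _ _ _).trans (add_le_add (add_le_add h5 h6) (hr a))
    have h9 : eps * U * (6 - α) ≤ α * (lam + rho) := by
      have e1 : eps * (U * (6 - α)) ≤ eps * (6 * cG * (lam + rho)) :=
        mul_le_mul_of_nonneg_left hUb heps
      have e2 : (cG * eps) * (lam + rho) ≤ α / 6 * (lam + rho) :=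
        mul_le_mul_of_nonneg_right hsmall.le (by linarith)
      linarith
    -- After inserting the bounds on `eps * U` and `rho`, a slack of `2 * α * lam` remains.
    have h10 : |g a| * (6 - α) < lam * (6 - α) := by
      have e1 : |g a| * (6 - α) ≤
          ((1 - α) * (lam + rho + eps * U) + eps * U + rho) * (6 - α) :=
        mul_le_mul_of_nonneg_right h8 (by linarith)
      have e2 : (2 - α) * (eps * U * (6 - α)) ≤ (2 - α) * (α * (lam + rho)) :=
        mul_le_mul_of_nonneg_left h9 h2α.le
      nlinarith [mul_pos hα hlam]
    exact lt_of_mul_lt_mul_right h10 (by linarith)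

end Witness

/-! ### Perturbation of the Gram matrix and of the gradient at the true drift. -/

section Perturbation

variable {p : ℕ}

lemma toEuclideanCLM_norm_eq (A : Matrix (Fin p) (Fin p) ℝ) :
    ‖Matrix.toEuclideanCLM (𝕜 := ℝ) A‖ = spectralNorm A := rfl

lemma spectralNorm_nonneg (A : Matrix (Fin p) (Fin p) ℝ) : 0 ≤ spectralNorm A :=
  norm_nonneg (Matrix.toEuclideanCLM (𝕜 := ℝ) A)

lemma spectralNorm_add_le (A B : Matrix (Fin p) (Fin p) ℝ) :
    spectralNorm (A + B) ≤ spectralNorm A + spectralNorm B := by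
  open scoped Matrix.Norms.L2Operator in exact norm_add_le A B

lemma sum_mulVec_sq_le (A : Matrix (Fin p) (Fin p) ℝ) (v : Fin p → ℝ) :
    ∑ i, (A *ᵥ v) i ^ 2 ≤ spectralNorm A ^ 2 * ∑ i, v i ^ 2 := by
  have h := (Matrix.toEuclideanCLM (𝕜 := ℝ) A).le_opNorm (WithLp.toLp 2 v)
  rw [toEuclideanCLM_norm_eq, Matrix.toEuclideanCLM_toLp] at h
  have h2 := pow_le_pow_left₀ (norm_nonneg _) h 2
  rw [mul_pow, EuclideanSpace.real_norm_sq_eq, EuclideanSpace.real_norm_sq_eq] at h2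
  exact h2

lemma norm_toLp_vec_sq (X : Matrix (Fin p) (Fin p) ℝ) :
    ‖WithLp.toLp 2 X.vec‖ ^ 2 = ∑ j, ∑ i, X i j ^ 2 := by
  rw [EuclideanSpace.real_norm_sq_eq, Fintype.sum_prod_type]
  rfl

lemma norm_toLp_vec_transpose (X : Matrix (Fin p) (Fin p) ℝ) :
    ‖WithLp.toLp 2 Xᵀ.vec‖ = ‖WithLp.toLp 2 X.vec‖ := by
  rw [← sq_eq_sq₀ (norm_nonneg _) (norm_nonneg _), norm_toLp_vec_sq, norm_toLp_vec_sq,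
    Finset.sum_comm]
  rfl

lemma norm_toLp_vec_mul_le (A X : Matrix (Fin p) (Fin p) ℝ) :
    ‖WithLp.toLp 2 (A * X).vec‖ ≤ spectralNorm A * ‖WithLp.toLp 2 X.vec‖ := by
  refine le_of_sq_le_sq ?_ (mul_nonneg (spectralNorm_nonneg A) (norm_nonneg _))
  rw [mul_pow, norm_toLp_vec_sq, norm_toLp_vec_sq, Finset.mul_sum]
  exact Finset.sum_le_sum fun j _ => sum_mulVec_sq_le A (X.col j)

lemma commMatrix_mulVec_vec (X : Matrix (Fin p) (Fin p) ℝ) :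
    commMatrix p *ᵥ X.vec = Xᵀ.vec := by
  ext ⟨i, j⟩
  simp only [commMatrix, Matrix.mulVec, dotProduct, Matrix.of_apply, ite_mul, one_mul, zero_mul]
  rw [Finset.sum_eq_single (j, i)]
  · simp [Matrix.vec]
  · intro b _ hb
    rw [if_neg]
    rintro h
    exact hb (by rw [← Prod.swap_swap b, ← h]; rfl)
  · simp

lemma lyapMatrix_mulVec_vec (S X : Matrix (Fin p) (Fin p) ℝ) :
    lyapMatrix S *ᵥ X.vec = (X * Sᵀ + S * Xᵀ).vec := by
  rw [lyapMatrix, Matrix.add_mulVec, ← Matrix.mulVec_mulVec, commMatrix_mulVec_vec,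
    Matrix.kronecker_mulVec_vec, Matrix.kronecker_mulVec_vec, Matrix.vec_add]
  simp

lemma lyapMatrix_sub (S T : Matrix (Fin p) (Fin p) ℝ) :
    lyapMatrix (S - T) = lyapMatrix S - lyapMatrix T := by
  have h1 : (S - T) ⊗ₖ (1 : Matrix (Fin p) (Fin p) ℝ) = S ⊗ₖ 1 - T ⊗ₖ 1 := by
    ext a b; simp [Matrix.kroneckerMap_apply, sub_mul]
  have h2 : (1 : Matrix (Fin p) (Fin p) ℝ) ⊗ₖ (S - T) = 1 ⊗ₖ S - 1 ⊗ₖ T := by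
    ext a b; simp [Matrix.kroneckerMap_apply, mul_sub]
  rw [lyapMatrix, lyapMatrix, lyapMatrix, h1, h2, Matrix.sub_mul]
  abel

/-- The two summands of the Lyapunov operator are transposes of each other, and each costs one
factor of the spectral norm. -/
lemma norm_lyapMatrix_mulVec_le (S : Matrix (Fin p) (Fin p) ℝ) (w : Fin p × Fin p → ℝ) :
    ‖WithLp.toLp 2 (lyapMatrix S *ᵥ w)‖ ≤ 2 * spectralNorm S * ‖WithLp.toLp 2 w‖ := by
  obtain ⟨X, rfl⟩ := Matrix.vec_bijective.2 w
  have h1 : X * Sᵀ = (S * Xᵀ)ᵀ := by simp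
  rw [lyapMatrix_mulVec_vec, Matrix.vec_add, WithLp.toLp_add]
  refine (norm_add_le _ _).trans ?_
  rw [h1, norm_toLp_vec_transpose]
  have := norm_toLp_vec_mul_le S Xᵀ
  rw [norm_toLp_vec_transpose] at this
  linarith

lemma abs_dotProduct_le {ι : Type*} [Fintype ι] (v w : ι → ℝ) :
    |v ⬝ᵥ w| ≤ ‖WithLp.toLp 2 v‖ * ‖WithLp.toLp 2 w‖ := by
  have := abs_real_inner_le_norm (WithLp.toLp 2 w) (WithLp.toLp 2 v)
  rw [EuclideanSpace.inner_toLp_toLp] at this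
  rw [mul_comm]
  simpa using this

lemma dotProduct_gram_mulVec (S : Matrix (Fin p) (Fin p) ℝ) (v w : Fin p × Fin p → ℝ) :
    v ⬝ᵥ gram S *ᵥ w = (lyapMatrix S *ᵥ v) ⬝ᵥ (lyapMatrix S *ᵥ w) := by
  rw [gram, ← Matrix.mulVec_mulVec, Matrix.dotProduct_mulVec, Matrix.vecMul_transpose]

lemma abs_lyap_dotProduct_le (S T : Matrix (Fin p) (Fin p) ℝ) (v w : Fin p × Fin p → ℝ) :
    |(lyapMatrix S *ᵥ v) ⬝ᵥ (lyapMatrix T *ᵥ w)| ≤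
      4 * spectralNorm S * spectralNorm T * ‖WithLp.toLp 2 v‖ * ‖WithLp.toLp 2 w‖ := by
  refine (abs_dotProduct_le _ _).trans ?_
  refine (mul_le_mul (norm_lyapMatrix_mulVec_le S v) (norm_lyapMatrix_mulVec_le T w)
    (norm_nonneg _) ?_).trans_eq (by ring)
  have := spectralNorm_nonneg S
  positivity

/-- Telescoping gives `A(T)ᵀA(T) - A(S)ᵀA(S) = A(T-S)ᵀA(T) + A(S)ᵀA(T-S)`. The bound is `4δ(‖S‖ + δ)
+ 4δ‖S‖`, and `δ ≤ 1` linearizes it. -/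
lemma abs_dotProduct_gram_sub_le {S T : Matrix (Fin p) (Fin p) ℝ} {δ : ℝ}
    (hδ : spectralNorm (T - S) ≤ δ) (hδ1 : δ ≤ 1) (v w : Fin p × Fin p → ℝ) :
    |v ⬝ᵥ (gram T - gram S) *ᵥ w| ≤
      δ * (4 + 8 * spectralNorm S) * ‖WithLp.toLp 2 v‖ * ‖WithLp.toLp 2 w‖ := by
  have hT : spectralNorm T ≤ spectralNorm S + δ := by
    have := spectralNorm_add_le S (T - S)
    rw [add_sub_cancel] at this
    linarith
  have hS0 := spectralNorm_nonneg S
  have hT0 := spectralNorm_nonneg T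
  have hd0 := spectralNorm_nonneg (T - S)
  have hδ0 := hd0.trans hδ
  have h1 : v ⬝ᵥ (gram T - gram S) *ᵥ w =
      (lyapMatrix (T - S) *ᵥ v) ⬝ᵥ (lyapMatrix T *ᵥ w)
        + (lyapMatrix S *ᵥ v) ⬝ᵥ (lyapMatrix (T - S) *ᵥ w) := by
    rw [Matrix.sub_mulVec, dotProduct_sub, dotProduct_gram_mulVec, dotProduct_gram_mulVec,
      lyapMatrix_sub, Matrix.sub_mulVec, Matrix.sub_mulVec, sub_dotProduct, dotProduct_sub]
    ring
  rw [h1]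
  refine (abs_add_le _ _).trans ((add_le_add (abs_lyap_dotProduct_le _ _ _ _)
    (abs_lyap_dotProduct_le _ _ _ _)).trans ?_)
  rw [← add_mul, ← add_mul]
  gcongr
  have e1 : spectralNorm (T - S) * spectralNorm T ≤ δ * (spectralNorm S + δ) := by gcongr
  have e2 : spectralNorm (T - S) * spectralNorm S ≤ δ * spectralNorm S := by gcongr
  have e3 : δ * δ ≤ δ * 1 := mul_le_mul_of_nonneg_left hδ1 (hd0.trans hδ)
  nlinarith

lemma norm_toLp_le_of_support {ι : Type*} [Fintype ι] {S : Finset ι} {w : ι → ℝ} {b : ℝ}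
    (hb : 0 ≤ b) (hw : ∀ q, q ∉ S → w q = 0) (hwb : ∀ q ∈ S, |w q| ≤ b) :
    ‖WithLp.toLp 2 w‖ ≤ √(S.card : ℝ) * b := by
  refine le_of_sq_le_sq ?_ (by positivity)
  rw [EuclideanSpace.real_norm_sq_eq, mul_pow, Real.sq_sqrt (by positivity)]
  calc ∑ q, w q ^ 2 = ∑ q ∈ S, w q ^ 2 :=
        (Finset.sum_subset (Finset.subset_univ S) fun q _ hq => by rw [hw q hq]; ring).symm
    _ ≤ ∑ _q ∈ S, b ^ 2 := Finset.sum_le_sum fun q hq => by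
        rw [← sq_abs (w q)]; exact pow_le_pow_left₀ (abs_nonneg _) (hwb q hq) 2
    _ = _ := by simp

/-- The absolute row sum is the bilinear form of the difference at a unit vector and the sign vector
of the row on `J`, whose Euclidean norm is at most the root of `J.card`. -/
lemma sum_abs_gram_sub_le {T S : Matrix (Fin p) (Fin p) ℝ} {δ : ℝ}
    (hδ : spectralNorm (T - S) ≤ δ) (hδ1 : δ ≤ 1) (J : Finset (Fin p × Fin p))
    (a : Fin p × Fin p) :
    ∑ q ∈ J, |(gram T - gram S) a q| ≤ √(J.card : ℝ) * (δ * (4 + 8 * spectralNorm S)) := by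
  set D := gram T - gram S with hD
  set w : Fin p × Fin p → ℝ := fun q => if q ∈ J then (SignType.sign (D a q) : ℝ) else 0 with hw
  have h1 : ∑ q ∈ J, |D a q| = Pi.single a 1 ⬝ᵥ D *ᵥ w := by
    rw [single_one_dotProduct, Matrix.mulVec, dotProduct]
    rw [← Finset.sum_subset (Finset.subset_univ J) fun q _ hq => by simp [hw, hq]]
    refine Finset.sum_congr rfl fun q hq => ?_
    simp only [hw, hq, if_true]
    exact (self_mul_sign _).symm
  have h2 : ‖WithLp.toLp 2 w‖ ≤ √(J.card : ℝ) * 1 := by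
    refine norm_toLp_le_of_support zero_le_one (fun q hq => by simp [hw, hq]) fun q hq => ?_
    simp only [hw, hq, if_true]
    rcases SignType.sign (D a q) with _ | _ | _ <;> simp
  have h3 : ‖WithLp.toLp 2 (Pi.single a 1 : Fin p × Fin p → ℝ)‖ = 1 := by
    simp
  have h4 := abs_dotProduct_gram_sub_le hδ hδ1 (Pi.single a 1) w
  rw [← hD, ← h1, h3, mul_one] at h4
  have h0 : 0 ≤ δ * (4 + 8 * spectralNorm S) := by
    have := spectralNorm_nonneg S
    have := (spectralNorm_nonneg (T - S)).trans hδ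
    positivity
  refine (le_abs_self _).trans (h4.trans ?_)
  rw [mul_comm]
  gcongr
  simpa using h2

/-- The Lyapunov equation eliminates `C`, so the gradient at the truth carries a factor `A(T - S)`;
the sparsity of `M` supplies the square root. -/
lemma abs_lassoGrad_le {T S M C : Matrix (Fin p) (Fin p) ℝ} {δ : ℝ}
    (hS : Sᵀ = S) (hM : M * S + S * Mᵀ + C = 0)
    (hδ : spectralNorm (T - S) ≤ δ) (hδ1 : δ ≤ 1) (a : Fin p × Fin p) :
    |lassoGrad (lyapMatrix T) C.vec M.vec a| ≤
      √((vecSupport M).card : ℝ) * (δ * (4 + 8 * spectralNorm S)) * maxNorm M := by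
  have h1 : C.vec = -(lyapMatrix S *ᵥ M.vec) := by
    rw [lyapMatrix_mulVec_vec, hS, ← Matrix.vec_neg, eq_neg_of_add_eq_zero_right hM]
  have h2 : lassoGrad (lyapMatrix T) C.vec M.vec a
      = (lyapMatrix T *ᵥ Pi.single a 1) ⬝ᵥ (lyapMatrix (T - S) *ᵥ M.vec) := by
    have := lassoGrad_dotProduct (lyapMatrix T) C.vec M.vec (Pi.single a 1)
    rw [dotProduct_single_one] at this
    rw [this, h1, dotProduct_comm, lyapMatrix_sub, Matrix.sub_mulVec, sub_eq_add_neg]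
  have h3 : ‖WithLp.toLp 2 (Pi.single a 1 : Fin p × Fin p → ℝ)‖ = 1 := by
    simp
  have h4 : ‖WithLp.toLp 2 M.vec‖ ≤ √((vecSupport M).card : ℝ) * maxNorm M := by
    refine norm_toLp_le_of_support (norm_nonneg _) (fun q hq => ?_)
      fun q _ => norm_le_pi_norm M.vec q
    by_contra h
    exact hq (Finset.mem_filter.2 ⟨Finset.mem_univ q, h⟩)
  have hT : spectralNorm T ≤ spectralNorm S + δ := by
    have := spectralNorm_add_le S (T - S)
    rw [add_sub_cancel] at this
    linarith
  have hS0 := spectralNorm_nonneg S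
  have hT0 := spectralNorm_nonneg T
  have hd0 := spectralNorm_nonneg (T - S)
  have hδ0 := hd0.trans hδ
  have h0 : 0 ≤ δ * (4 + 8 * spectralNorm S) := by
    have := hd0.trans hδ
    positivity
  rw [h2]
  refine (abs_lyap_dotProduct_le _ _ _ _).trans ?_
  rw [h3, mul_one]
  calc _ ≤ (δ * (4 + 8 * spectralNorm S)) * (√((vecSupport M).card : ℝ) * maxNorm M) := by
        refine mul_le_mul ?_ h4 (norm_nonneg _) h0
        have e1 : spectralNorm (T - S) * spectralNorm T ≤ δ * (spectralNorm S + δ) := by gcongr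
        have e3 : δ * δ ≤ δ * 1 := mul_le_mul_of_nonneg_left hδ1 (hd0.trans hδ)
        have e4 : 0 ≤ δ * spectralNorm S := mul_nonneg (hd0.trans hδ) hS0
        nlinarith
    _ = _ := by ring

end Perturbation

/-! ### Spectral norms from a net of the sphere. -/

section Net

variable {p : ℕ}

/-- The unit sphere has a `1/2`-net with at most `5 ^ p` points. -/
lemma exists_sphere_net (p : ℕ) : ∃ N : Finset (EuclideanSpace ℝ (Fin p)),
    N.card ≤ 5 ^ p ∧ (∀ v ∈ N, ‖v‖ = 1) ∧ ∀ x : EuclideanSpace ℝ (Fin p), ‖x‖ = 1 →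
      ∃ v ∈ N, ‖x - v‖ ≤ 1 / 2 := by
  classical
  let Q : Finset (EuclideanSpace ℝ (Fin p)) → Prop := fun N =>
    (∀ v ∈ N, ‖v‖ = 1) ∧ ∀ v ∈ N, ∀ w ∈ N, v ≠ w → 1 / 2 ≤ ‖v - w‖
  have hcard : ∀ N, Q N → N.card ≤ 5 ^ p := by
    intro N hN
    -- Doubling turns separation `1/2` on the unit sphere into separation `1` in the ball of radius
    -- `2`, the normalization of the Besicovitch packing bound.
    have hinj : Function.Injective fun v : EuclideanSpace ℝ (Fin p) => (2 : ℝ) • v :=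
      smul_right_injective _ two_ne_zero
    have h := Besicovitch.card_le_of_separated (N.image fun v => (2 : ℝ) • v)
      (by
        simp only [Finset.mem_image, forall_exists_index, and_imp]
        rintro _ v hv rfl
        simp [norm_smul, hN.1 v hv])
      (by
        simp only [Finset.mem_image, forall_exists_index, and_imp]
        rintro _ v hv rfl _ w hw rfl hne
        have := hN.2 v hv w hw (fun h => hne (by rw [h]))
        rw [← smul_sub, norm_smul]
        norm_num
        linarith)
    rwa [Finset.card_image_of_injective _ hinj, finrank_euclideanSpace_fin] at h
  -- A separated set of largest cardinality is a net: a point far from all of it could be added.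
  obtain ⟨N, hN, hmax⟩ : ∃ N, Q N ∧ ∀ N', Q N' → N'.card ≤ N.card := by
    obtain ⟨k, ⟨N, hN, hk⟩, hkmax⟩ :=
      Nat.findGreatest_spec (P := fun k => ∃ N, Q N ∧ N.card = k) (m := 0) (n := 5 ^ p)
        (Nat.zero_le _) ⟨∅, ⟨by simp, by simp⟩, rfl⟩ |> fun h =>
        (⟨_, h, fun N' hN' => Nat.le_findGreatest (hcard N' hN') ⟨N', hN', rfl⟩⟩ :
          ∃ k, (∃ N, Q N ∧ N.card = k) ∧ ∀ N', Q N' → N'.card ≤ k)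
    exact ⟨N, hN, fun N' h => (hkmax N' h).trans hk.ge⟩
  refine ⟨N, hcard N hN, hN.1, fun x hx => ?_⟩
  by_contra! hfar
  have hxN : x ∉ N := fun h => by
    have := hfar x h
    norm_num at this
  have := hmax (insert x N) ⟨by
      simp only [Finset.mem_insert]
      rintro v (rfl | hv)
      exacts [hx, hN.1 v hv], by
      simp only [Finset.mem_insert]
      rintro v (rfl | hv) w (rfl | hw) hne
      · exact absurd rfl hne
      · exact (hfar w hw).le
      · rw [norm_sub_rev]; exact (hfar v hv).le
      · exact hN.2 v hv w hw hne⟩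
  rw [Finset.card_insert_of_notMem hxN] at this
  omega

lemma inner_toEuclideanCLM_comm {T : Matrix (Fin p) (Fin p) ℝ} (hT : Tᵀ = T)
    (x y : EuclideanSpace ℝ (Fin p)) :
    inner ℝ (Matrix.toEuclideanCLM (𝕜 := ℝ) T x) y
      = inner ℝ x (Matrix.toEuclideanCLM (𝕜 := ℝ) T y) := by
  rw [real_inner_comm, Matrix.inner_toEuclideanCLM, Matrix.inner_toEuclideanCLM,
    Matrix.dotProduct_mulVec, ← Matrix.mulVec_transpose, hT, dotProduct_comm]

/-- Polarization and the parallelogram law bound the bilinear form on unit vectors; then test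
against the direction of `L y`. -/
lemma spectralNorm_le_of_quadratic {T : Matrix (Fin p) (Fin p) ℝ} (hT : Tᵀ = T) {b : ℝ}
    (hb : 0 ≤ b) (h : ∀ x : EuclideanSpace ℝ (Fin p),
      |inner ℝ x (Matrix.toEuclideanCLM (𝕜 := ℝ) T x)| ≤ b * ‖x‖ ^ 2) :
    spectralNorm T ≤ b := by
  rw [← toEuclideanCLM_norm_eq]
  set L := Matrix.toEuclideanCLM (𝕜 := ℝ) T with hL
  have hbil : ∀ x y, ‖x‖ = 1 → ‖y‖ = 1 → inner ℝ x (L y) ≤ b := by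
    intro x y hx hy
    have h1 := (le_abs_self _).trans (h (x + y))
    have h2 := (neg_le_abs _).trans (h (x - y))
    have h3 : inner ℝ y (L x) = inner ℝ x (L y) := by
      rw [← inner_toEuclideanCLM_comm hT, real_inner_comm]
    have h4 := parallelogram_law_with_norm ℝ x y
    rw [map_add, inner_add_left, inner_add_right, inner_add_right, h3] at h1
    rw [map_sub, inner_sub_left, inner_sub_right, inner_sub_right, h3] at h2
    rw [hx, hy] at h4
    have h5 : b * (‖x + y‖ ^ 2 + ‖x - y‖ ^ 2) = b * 4 := by
      congr 1; linarith
    linarith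
  refine L.opNorm_le_of_unit_norm hb fun y hy => ?_
  by_cases h0 : L y = 0
  · simpa [h0] using hb
  have hn := norm_pos_iff.2 h0
  have h1 := hbil (‖L y‖⁻¹ • L y) y (by rw [norm_smul, norm_inv, norm_norm]; field_simp) hy
  rw [real_inner_smul_left, real_inner_self_eq_norm_sq] at h1
  have : ‖L y‖⁻¹ * ‖L y‖ ^ 2 = ‖L y‖ := by field_simp
  linarith

/-- By symmetry the quadratic forms at `x` and `v` differ by the form at `x - v` and `x + v`. For
unit vectors at distance at most `1/2`, `‖x - v‖ * ‖x + v‖ ≤ √(15/16) < 31/32`, so the norm is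
absorbed at the price of the factor `32`. -/
lemma spectralNorm_le_of_net {T : Matrix (Fin p) (Fin p) ℝ} (hT : Tᵀ = T)
    {N : Finset (EuclideanSpace ℝ (Fin p))} (hN : ∀ v ∈ N, ‖v‖ = 1)
    (hnet : ∀ x : EuclideanSpace ℝ (Fin p), ‖x‖ = 1 → ∃ v ∈ N, ‖x - v‖ ≤ 1 / 2)
    {b : ℝ} (hb : 0 ≤ b)
    (h : ∀ v ∈ N, |inner ℝ v (Matrix.toEuclideanCLM (𝕜 := ℝ) T v)| ≤ b) :
    spectralNorm T ≤ 32 * b := by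
  set L := Matrix.toEuclideanCLM (𝕜 := ℝ) T with hL
  have hLn : ‖L‖ = spectralNorm T := toEuclideanCLM_norm_eq T
  have hT0 := spectralNorm_nonneg T
  have hunit : ∀ x, ‖x‖ = 1 → |inner ℝ x (L x)| ≤ b + 31 / 32 * spectralNorm T := by
    intro x hx
    obtain ⟨v, hv, hxv⟩ := hnet x hx
    have h1 : inner ℝ x (L x) = inner ℝ v (L v) + inner ℝ (x - v) (L (x + v)) := by
      have h3 : inner ℝ v (L x) = inner ℝ x (L v) := by
        rw [← inner_toEuclideanCLM_comm hT, real_inner_comm]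
      rw [map_add, inner_sub_left, inner_add_right, inner_add_right, h3]
      ring
    have h2 : |inner ℝ (x - v) (L (x + v))| ≤ ‖x - v‖ * (spectralNorm T * ‖x + v‖) := by
      refine (abs_real_inner_le_norm _ _).trans ?_
      rw [← hLn]
      exact mul_le_mul_of_nonneg_left (L.le_opNorm _) (norm_nonneg _)
    have h4 := parallelogram_law_with_norm ℝ x v
    rw [hx, hN v hv] at h4
    have h5 : ‖x - v‖ * ‖x + v‖ ≤ 31 / 32 := by
      refine le_of_sq_le_sq ?_ (by norm_num)
      have h6 : ‖x + v‖ ^ 2 = 4 - ‖x - v‖ ^ 2 := by linarith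
      have h7 : ‖x - v‖ ^ 2 ≤ 1 / 4 := by nlinarith [norm_nonneg (x - v)]
      rw [mul_pow, h6]
      nlinarith [sq_nonneg ‖x - v‖]
    rw [h1]
    refine (abs_add_le _ _).trans (add_le_add (h v hv) (h2.trans ?_))
    nlinarith
  have hq : ∀ x : EuclideanSpace ℝ (Fin p),
      |inner ℝ x (L x)| ≤ (b + 31 / 32 * spectralNorm T) * ‖x‖ ^ 2 := by
    intro x
    by_cases h0 : x = 0
    · simp [h0]
    have hn := norm_pos_iff.2 h0
    have h1 := hunit (‖x‖⁻¹ • x) (by rw [norm_smul, norm_inv, norm_norm]; field_simp)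
    rw [map_smul, real_inner_smul_left, real_inner_smul_right, ← mul_assoc, abs_mul,
      abs_of_pos (by positivity), ← mul_inv, ← sq, inv_mul_le_iff₀ (by positivity)] at h1
    linarith
  have := spectralNorm_le_of_quadratic hT (by positivity) hq
  linarith

end Net

/-! ### Decay of the matrix exponential of a stable matrix. -/

section Stability

variable {p : ℕ}

open scoped Matrix.Norms.L2Operator in
lemma exp_mulVec_of_eigenvector {A : Matrix (Fin p) (Fin p) ℂ} {c : ℂ} {v : Fin p → ℂ}
    (h : A *ᵥ v = c • v) : NormedSpace.exp A *ᵥ v = Complex.exp c • v := by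
  have hpow : ∀ n : ℕ, A ^ n *ᵥ v = c ^ n • v := by
    intro n
    induction n with
    | zero => simp
    | succ n ih => rw [pow_succ, ← Matrix.mulVec_mulVec, h, Matrix.mulVec_smul, ih, smul_smul,
        pow_succ, mul_comm]
  have h1 := NormedSpace.exp_series_hasSum_exp' (𝕂 := ℂ) A
  have hL : Continuous fun B : Matrix (Fin p) (Fin p) ℂ => B *ᵥ v := by fun_prop
  let φ : Matrix (Fin p) (Fin p) ℂ →+ (Fin p → ℂ) :=
    { toFun := fun B => B *ᵥ v
      map_zero' := by simp
      map_add' := fun B B' => Matrix.add_mulVec B B' v }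
  have h2 : HasSum (fun n : ℕ => ((n.factorial : ℂ)⁻¹ • A ^ n) *ᵥ v) (NormedSpace.exp A *ᵥ v) :=
    h1.map φ hL
  have h3 := (NormedSpace.exp_series_hasSum_exp' (𝕂 := ℂ) c).smul_const v
  have h4 : (fun n : ℕ => ((n.factorial : ℂ)⁻¹ • A ^ n) *ᵥ v)
      = fun n : ℕ => ((n.factorial : ℂ)⁻¹ • c ^ n) • v := by
    funext n
    rw [Matrix.smul_mulVec, hpow, smul_smul, smul_eq_mul]
  rw [h4] at h2
  rw [Complex.exp_eq_exp_ℂ]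
  exact h2.unique h3

/-- An eigenspace of `exp A` is invariant under `A`, which commutes with `exp A`, hence contains an
eigenvector of `A`. -/
lemma exists_spectrum_of_spectrum_exp {A : Matrix (Fin p) (Fin p) ℂ} {z : ℂ}
    (hz : z ∈ spectrum ℂ (NormedSpace.exp A)) : ∃ c ∈ spectrum ℂ A, z = Complex.exp c := by
  rw [← Matrix.spectrum_toLin', ← Module.End.hasEigenvalue_iff_mem_spectrum] at hz
  set f : Module.End ℂ (Fin p → ℂ) := A.toLin' with hf
  set g : Module.End ℂ (Fin p → ℂ) := (NormedSpace.exp A).toLin' with hg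
  have hcomm : Commute g f := by
    have h1 : Commute (NormedSpace.exp A) A := by
      open scoped Matrix.Norms.L2Operator in exact (Commute.refl A).exp_left
    rw [Commute, SemiconjBy, hf, hg, Module.End.mul_eq_comp, Module.End.mul_eq_comp,
      ← Matrix.toLin'_mul, ← Matrix.toLin'_mul, h1.eq]
  have hmaps : Set.MapsTo f (g.eigenspace z) (g.eigenspace z) :=
    Module.End.mapsTo_genEigenspace_of_comm hcomm z 1
  have : Nontrivial (g.eigenspace z) := Submodule.nontrivial_iff_ne_bot.2 hz
  obtain ⟨c, hc⟩ := Module.End.exists_eigenvalue (f.restrict hmaps)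
  obtain ⟨w, hw⟩ := hc.exists_hasEigenvector
  have hw0 : (w : Fin p → ℂ) ≠ 0 := fun h => hw.2 (Subtype.ext h)
  have hfw : A *ᵥ (w : Fin p → ℂ) = c • (w : Fin p → ℂ) := by
    have h1 : f w = c • (w : Fin p → ℂ) := congrArg Subtype.val hw.apply_eq_smul
    rwa [hf, Matrix.toLin'_apply] at h1
  refine ⟨c, ?_, ?_⟩
  · rw [← Matrix.spectrum_toLin', ← Module.End.hasEigenvalue_iff_mem_spectrum]
    exact Module.End.hasEigenvalue_of_hasEigenvector
      ⟨Module.End.mem_eigenspace_iff.2 (by simpa using hfw), hw0⟩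
  · have h1 := exp_mulVec_of_eigenvector hfw
    have h2 : NormedSpace.exp A *ᵥ (w : Fin p → ℂ) = z • (w : Fin p → ℂ) := by
      simpa [hg] using Module.End.mem_eigenspace_iff.1 w.2
    exact smul_left_injective ℂ hw0 (h2.symm.trans h1)

open scoped Matrix.Norms.L2Operator in
-- By Gelfand's formula the norms of the powers are eventually below those of some `r < 1`.
lemma tendsto_pow_of_spectrum {A : Matrix (Fin p) (Fin p) ℂ} (hp : 0 < p)
    (h : ∀ z ∈ spectrum ℂ A, ‖z‖ < 1) :
    Filter.Tendsto (fun k : ℕ => A ^ k) Filter.atTop (nhds 0) := by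
  have : Nonempty (Fin p) := ⟨⟨0, hp⟩⟩
  have hr : spectralRadius ℂ A < (1 : NNReal) :=
    spectrum.spectralRadius_lt_of_forall_lt A fun z hz => by
      rw [← NNReal.coe_lt_coe]; exact h z hz
  obtain ⟨r, hr1, hr2⟩ := ENNReal.lt_iff_exists_nnreal_btwn.1 hr
  have hr2' : (r : ℝ) < 1 := by exact_mod_cast hr2
  have hev := (spectrum.pow_nnnorm_pow_one_div_tendsto_nhds_spectralRadius A).eventually
    (gt_mem_nhds hr1)
  rw [tendsto_zero_iff_norm_tendsto_zero]
  refine squeeze_zero' (Filter.Eventually.of_forall fun _ => norm_nonneg _) ?_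
    (tendsto_pow_atTop_nhds_zero_of_lt_one r.2 hr2')
  filter_upwards [hev, Filter.eventually_gt_atTop 0] with k hk hk0
  have hk0' : (k : ℝ) ≠ 0 := by positivity
  have h1 : ((‖A ^ k‖₊ : ENNReal) ^ (1 / k : ℝ)) ^ (k : ℝ) ≤ (r : ENNReal) ^ (k : ℝ) :=
    ENNReal.rpow_le_rpow hk.le (by positivity)
  rw [← ENNReal.rpow_mul, one_div, inv_mul_cancel₀ hk0', ENNReal.rpow_one,
    ENNReal.rpow_natCast] at h1
  exact_mod_cast h1

lemma exp_nat_smul (M : Matrix (Fin p) (Fin p) ℝ) (k : ℕ) :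
    NormedSpace.exp ((k : ℝ) • M) = NormedSpace.exp M ^ k := by
  rw [Nat.cast_smul_eq_nsmul, Matrix.exp_nsmul]

lemma IsStable.tendsto_exp {M : Matrix (Fin p) (Fin p) ℝ} (hM : IsStable M) (hp : 0 < p) :
    Filter.Tendsto (fun k : ℕ => NormedSpace.exp ((k : ℝ) • M)) Filter.atTop (nhds 0) := by
  have hmap : (NormedSpace.exp M).map (algebraMap ℝ ℂ)
      = NormedSpace.exp (M.map (algebraMap ℝ ℂ)) := by
    open scoped Matrix.Norms.L2Operator in
    let : NormedAlgebra ℚ (Matrix (Fin p) (Fin p) ℝ) := .restrictScalars ℚ ℝ _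
    exact NormedSpace.map_exp ((algebraMap ℝ ℂ).mapMatrix (m := Fin p))
      (continuous_id.matrix_map (Complex.continuous_ofReal)) M
  have h1 := tendsto_pow_of_spectrum (A := NormedSpace.exp (M.map (algebraMap ℝ ℂ))) hp
    (fun z hz => by
      obtain ⟨c, hc, rfl⟩ := exists_spectrum_of_spectrum_exp hz
      rw [Complex.norm_exp]
      exact (Real.exp_lt_exp.2 (hM c hc)).trans_eq Real.exp_zero)
  have hre : Continuous fun B : Matrix (Fin p) (Fin p) ℂ => B.map Complex.re :=
    continuous_id.matrix_map Complex.continuous_re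
  have h2 := (hre.tendsto 0).comp h1
  have h0 : (0 : Matrix (Fin p) (Fin p) ℂ).map Complex.re = 0 := by ext; simp
  rw [h0] at h2
  refine h2.congr fun k => ?_
  rw [exp_nat_smul, Function.comp_apply, ← hmap]
  have h3 : (NormedSpace.exp M).map (algebraMap ℝ ℂ) ^ k
      = (NormedSpace.exp M ^ k).map (algebraMap ℝ ℂ) :=
    (map_pow ((algebraMap ℝ ℂ).mapMatrix (m := Fin p)) _ k).symm
  rw [h3]
  ext i j
  simp

end Stability

/-! ### The equilibrium distribution is centered Gaussian with covariance `Sig`. -/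

section Covariance

variable {p : ℕ} {M C Sig : Matrix (Fin p) (Fin p) ℝ}

open scoped Matrix.Norms.L2Operator in
lemma hasDerivAt_exp_conj (M B : Matrix (Fin p) (Fin p) ℝ) (s : ℝ) :
    HasDerivAt (fun s : ℝ => NormedSpace.exp (s • M) * B * (NormedSpace.exp (s • M))ᵀ)
      (NormedSpace.exp (s • M) * (M * B + B * Mᵀ) * (NormedSpace.exp (s • M))ᵀ) s := by
  have h1 := hasDerivAt_exp_smul_const (𝕂 := ℝ) M s
  have h2 := hasDerivAt_exp_smul_const' (𝕂 := ℝ) Mᵀ s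
  have h3 : ∀ s : ℝ, NormedSpace.exp (s • Mᵀ) = (NormedSpace.exp (s • M))ᵀ := fun s => by
    rw [← Matrix.transpose_smul, Matrix.exp_transpose]
  simp only [h3] at h2
  exact ((h1.mul_const B).mul h2).congr_deriv (by noncomm_ring)

lemma hasDerivAt_exp_conj_apply (M B : Matrix (Fin p) (Fin p) ℝ) (i j : Fin p) (s : ℝ) :
    HasDerivAt (fun s : ℝ => (NormedSpace.exp (s • M) * B * (NormedSpace.exp (s • M))ᵀ) i j)
      ((NormedSpace.exp (s • M) * (M * B + B * Mᵀ) * (NormedSpace.exp (s • M))ᵀ) i j) s := by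
  open scoped Matrix.Norms.L2Operator in
  exact (Matrix.entryLinearMap ℝ ℝ i j).toContinuousLinearMap.hasFDerivAt.comp_hasDerivAt s
    (hasDerivAt_exp_conj M B s)

lemma continuous_exp_conj_apply (M B : Matrix (Fin p) (Fin p) ℝ) (i j : Fin p) :
    Continuous fun s : ℝ => (NormedSpace.exp (s • M) * B * (NormedSpace.exp (s • M))ᵀ) i j :=
  continuous_iff_continuousAt.2 fun s => (hasDerivAt_exp_conj_apply M B i j s).continuousAt

/-- By the Lyapunov equation, `-exp(sM) Sig exp(sM)ᵀ` is a primitive of the integrand. -/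
lemma ouCov_eq (h : M * Sig + Sig * Mᵀ + C = 0) (t : ℝ) :
    ouCov M C t = Sig - NormedSpace.exp (t • M) * Sig * (NormedSpace.exp (t • M))ᵀ := by
  ext i j
  have hC : C = -(M * Sig + Sig * Mᵀ) := eq_neg_of_add_eq_zero_right h
  have hder : ∀ s : ℝ, HasDerivAt
      (fun s : ℝ => -(NormedSpace.exp (s • M) * Sig * (NormedSpace.exp (s • M))ᵀ) i j)
      ((NormedSpace.exp (s • M) * C * (NormedSpace.exp (s • M))ᵀ) i j) s := fun s => by
    refine (hasDerivAt_exp_conj_apply M Sig i j s).neg.congr_deriv ?_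
    rw [hC, Matrix.mul_neg, Matrix.neg_mul, Matrix.neg_apply]
  rw [ouCov, Matrix.of_apply, intervalIntegral.integral_eq_sub_of_hasDerivAt
    (fun s _ => hder s) ((continuous_exp_conj_apply M C i j).intervalIntegrable _ _)]
  simp
  ring

lemma ouCov_posSemidef (hC : C.PosDef) {t : ℝ} (ht : 0 ≤ t) : (ouCov M C t).PosSemidef := by
  have hpsd : ∀ s : ℝ,
      (NormedSpace.exp (s • M) * C * (NormedSpace.exp (s • M))ᵀ).PosSemidef := fun s => by
    have := hC.posSemidef.mul_mul_conjTranspose_same (NormedSpace.exp (s • M))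
    rwa [Matrix.conjTranspose_eq_transpose_of_trivial] at this
  refine Matrix.PosSemidef.of_dotProduct_mulVec_nonneg ?_ fun x => ?_
  · ext i j
    simp only [ouCov, Matrix.conjTranspose_apply, Matrix.of_apply, star_trivial]
    congr 1
    ext s
    exact congrFun (congrFun (hpsd s).1 i) j
  · have h1 : star x ⬝ᵥ ouCov M C t *ᵥ x = ∫ s in (0 : ℝ)..t,
        star x ⬝ᵥ (NormedSpace.exp (s • M) * C * (NormedSpace.exp (s • M))ᵀ) *ᵥ x := by
      simp only [dotProduct, Matrix.mulVec, ouCov, Matrix.of_apply]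
      rw [intervalIntegral.integral_finsetSum]
      · refine Finset.sum_congr rfl fun i _ => ?_
        rw [intervalIntegral.integral_const_mul, intervalIntegral.integral_finsetSum]
        · simp only [intervalIntegral.integral_mul_const]
        · exact fun j _ => ((continuous_exp_conj_apply M C i j).mul_const _).intervalIntegrable _ _
      · exact fun i _ => (continuous_const.mul (continuous_finsetSum _ fun j _ =>
          (continuous_exp_conj_apply M C i j).mul_const _)).intervalIntegrable _ _
    rw [h1]
    exact intervalIntegral.integral_nonneg ht fun s _ => (hpsd s).dotProduct_mulVec_nonneg x

lemma tendsto_ouCov (hM : IsStable M) (hp : 0 < p) (h : M * Sig + Sig * Mᵀ + C = 0) :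
    Filter.Tendsto (fun k : ℕ => ouCov M C k) Filter.atTop (nhds Sig) := by
  have h1 := hM.tendsto_exp hp
  have hcont : Continuous fun E : Matrix (Fin p) (Fin p) ℝ => Sig - E * Sig * Eᵀ := by fun_prop
  have h2 := (hcont.tendsto 0).comp h1
  simp only [Matrix.zero_mul, sub_zero] at h2
  exact h2.congr fun k => (ouCov_eq h k).symm

/-- `Sig` is the limit of the transition covariances; symmetry, too, comes from this limit. -/
lemma equilibriumCov_posSemidef (hM : IsStable M) (hp : 0 < p) (hC : C.PosDef)
    (h : M * Sig + Sig * Mᵀ + C = 0) : Sig.PosSemidef := by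
  have ht := tendsto_ouCov hM hp h
  refine Matrix.PosSemidef.of_dotProduct_mulVec_nonneg ?_ fun x => ?_
  · have hc : Continuous fun B : Matrix (Fin p) (Fin p) ℝ => Bᴴ := continuous_id.matrix_conjTranspose
    exact tendsto_nhds_unique (((hc.tendsto Sig).comp ht).congr fun k =>
      (ouCov_posSemidef hC k.cast_nonneg).1) ht
  · have hc : Continuous fun B : Matrix (Fin p) (Fin p) ℝ => star x ⬝ᵥ B *ᵥ x := by fun_prop
    exact ge_of_tendsto' ((hc.tendsto Sig).comp ht) fun k =>
      (ouCov_posSemidef hC k.cast_nonneg).dotProduct_mulVec_nonneg x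

instance isMarkovKernel_ouKernel (M C : Matrix (Fin p) (Fin p) ℝ) (t : ℝ) :
    IsMarkovKernel (ouKernel M C t) :=
  ⟨fun x => by
    change IsProbabilityMeasure (multivariateGaussian _ _)
    infer_instance⟩

lemma charFun_ouKernel (hC : C.PosDef) {t : ℝ} (ht : 0 ≤ t) (x ξ : EuclideanSpace ℝ (Fin p)) :
    charFun (ouKernel M C t x) ξ =
      Complex.exp (inner ℝ x (Matrix.toEuclideanCLM (𝕜 := ℝ) (NormedSpace.exp (t • M))ᵀ ξ)
        * Complex.I) * Complex.exp (-((ξ ⬝ᵥ ouCov M C t *ᵥ ξ : ℝ) : ℂ) / 2) := by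
  change charFun (multivariateGaussian _ _) ξ = _
  have h1 : inner ℝ ξ (Matrix.toEuclideanCLM (𝕜 := ℝ) (NormedSpace.exp (t • M)) x)
      = inner ℝ x (Matrix.toEuclideanCLM (𝕜 := ℝ) (NormedSpace.exp (t • M))ᵀ ξ) := by
    rw [Matrix.inner_toEuclideanCLM, Matrix.inner_toEuclideanCLM, Matrix.mulVec_transpose,
      Matrix.dotProduct_mulVec, dotProduct_comm]
  rw [charFun_multivariateGaussian (ouCov_posSemidef hC ht), h1, ← Complex.exp_add]
  congr 1
  push_cast
  ring

/-- Integrate the transition characteristic function against `ν`. Along integer times the first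
factor tends to `1` and the second to the Gaussian one. -/
lemma charFun_of_invariant {ν : Measure (EuclideanSpace ℝ (Fin p))} [IsProbabilityMeasure ν]
    (hC : C.PosDef) {t : ℝ} (ht : 0 ≤ t) (hν : (ouKernel M C t).Invariant ν)
    (ξ : EuclideanSpace ℝ (Fin p)) :
    charFun ν ξ = charFun ν (Matrix.toEuclideanCLM (𝕜 := ℝ) (NormedSpace.exp (t • M))ᵀ ξ)
      * Complex.exp (-((ξ ⬝ᵥ ouCov M C t *ᵥ ξ : ℝ) : ℂ) / 2) := by
  have h1 : charFun ν ξ = ∫ x, charFun (ouKernel M C t x) ξ ∂ν := by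
    have hint : Integrable (fun y => Complex.exp (inner ℝ y ξ * Complex.I))
        ((ouKernel M C t ∘ₖ Kernel.const (EuclideanSpace ℝ (Fin p)) ν) 0) := by
      rw [hν.comp_const, Kernel.const_apply]
      refine (integrable_const (1 : ℝ)).mono' (by fun_prop) (Filter.Eventually.of_forall fun y => ?_)
      rw [Complex.norm_exp_ofReal_mul_I]
    have h2 := Kernel.integral_comp hint
    rw [hν.comp_const, Kernel.const_apply] at h2
    exact h2
  rw [h1]
  simp_rw [charFun_ouKernel hC ht]
  rw [integral_mul_const]
  rfl

/-- The equilibrium distribution is `N(0, Sig)`. -/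
lemma IsOUEquilibrium.charFun_eq (hM : IsStable M) (hp : 0 < p) (hC : C.PosDef)
    (h : M * Sig + Sig * Mᵀ + C = 0) {ν : Measure (EuclideanSpace ℝ (Fin p))}
    (hν : IsOUEquilibrium M C ν) (ξ : EuclideanSpace ℝ (Fin p)) :
    charFun ν ξ = Complex.exp (-((ξ ⬝ᵥ Sig *ᵥ ξ : ℝ) : ℂ) / 2) := by
  have := hν.1
  have h1 : Filter.Tendsto (fun k : ℕ => charFun ν
      (Matrix.toEuclideanCLM (𝕜 := ℝ) (NormedSpace.exp ((k : ℝ) • M))ᵀ ξ)) Filter.atTop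
      (nhds 1) := by
    have hc : Continuous fun E : Matrix (Fin p) (Fin p) ℝ =>
        charFun ν (Matrix.toEuclideanCLM (𝕜 := ℝ) Eᵀ ξ) := by
      refine continuous_charFun.comp ?_
      have : (fun E : Matrix (Fin p) (Fin p) ℝ => Matrix.toEuclideanCLM (𝕜 := ℝ) Eᵀ ξ)
          = fun E => WithLp.toLp 2 (Eᵀ *ᵥ ξ.ofLp) := rfl
      rw [this]
      exact (PiLp.continuous_toLp 2 _).comp (by fun_prop)
    have h2 := (hc.tendsto 0).comp (hM.tendsto_exp hp)
    have h0 : charFun ν (Matrix.toEuclideanCLM (𝕜 := ℝ) (0 : Matrix (Fin p) (Fin p) ℝ)ᵀ ξ) = 1 := by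
      simp
    rw [h0] at h2
    exact h2
  have h2 : Filter.Tendsto (fun k : ℕ => Complex.exp (-((ξ ⬝ᵥ ouCov M C k *ᵥ ξ : ℝ) : ℂ) / 2))
      Filter.atTop (nhds (Complex.exp (-((ξ ⬝ᵥ Sig *ᵥ ξ : ℝ) : ℂ) / 2))) := by
    have hc : Continuous fun B : Matrix (Fin p) (Fin p) ℝ =>
        Complex.exp (-((ξ.ofLp ⬝ᵥ B *ᵥ ξ.ofLp : ℝ) : ℂ) / 2) := by fun_prop
    exact (hc.tendsto Sig).comp (tendsto_ouCov hM hp h)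
  have h3 := (h1.mul h2).congr fun k : ℕ =>
    (charFun_of_invariant hC k.cast_nonneg (hν.2 k k.cast_nonneg) ξ).symm
  rw [one_mul] at h3
  exact tendsto_nhds_unique tendsto_const_nhds h3

lemma IsOUEquilibrium.map_inner (hM : IsStable M) (hp : 0 < p) (hC : C.PosDef)
    (h : M * Sig + Sig * Mᵀ + C = 0) {ν : Measure (EuclideanSpace ℝ (Fin p))}
    (hν : IsOUEquilibrium M C ν) (v : EuclideanSpace ℝ (Fin p)) :
    ν.map (fun x => inner ℝ v x) = gaussianReal 0 (v ⬝ᵥ Sig *ᵥ v).toNNReal := by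
  have := hν.1
  have hs : 0 ≤ v ⬝ᵥ Sig *ᵥ v :=
    (equilibriumCov_posSemidef hM hp hC h).dotProduct_mulVec_nonneg v.ofLp
  have : IsProbabilityMeasure (ν.map (fun x => inner ℝ v x)) :=
    Measure.isProbabilityMeasure_map (by fun_prop)
  refine Measure.ext_of_charFun (funext fun t => ?_)
  have h1 : charFun (ν.map (fun x => inner ℝ v x)) t = charFun ν (t • v) := by
    rw [charFun_apply, charFun_apply, integral_map (by fun_prop) (by fun_prop)]
    congr 1
    ext x
    rw [real_inner_smul_right, real_inner_comm v x]
    simp [mul_comm]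
  rw [h1, hν.charFun_eq hM hp hC h, charFun_gaussianReal]
  congr 1
  rw [WithLp.ofLp_smul, Matrix.mulVec_smul, smul_dotProduct, dotProduct_smul, Real.coe_toNNReal _ hs]
  push_cast
  simp
  ring

end Covariance

/-! ### Concentration of the sample covariance. -/

section Concentration

lemma neg_log_one_sub_le {w : ℝ} (h : |w| ≤ 1 / 2) : -Real.log (1 - w) ≤ w + 2 * w ^ 2 := by
  have h1 := Real.abs_log_sub_add_sum_range_le (x := w) (by linarith) 1
  simp only [Finset.sum_range_one, zero_add, pow_one, Nat.cast_zero, div_one] at h1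
  have h2 : |w| ^ (1 + 1) / (1 - |w|) ≤ 2 * w ^ 2 := by
    rw [div_le_iff₀ (by linarith), show (1 + 1) = 2 from rfl, sq_abs]
    nlinarith [sq_nonneg w]
  have h3 := (neg_le_abs _).trans (h1.trans h2)
  linarith

lemma integral_exp_mul_sq_gaussianReal {s : NNReal} (hs : s ≠ 0) {θ : ℝ}
    (h : 2 * (θ * s) < 1) :
    ∫ y, Real.exp (θ * (y ^ 2 - s)) ∂gaussianReal 0 s
      = Real.exp (-(θ * s)) / √(1 - 2 * (θ * s)) := by
  have hs0 : (0 : ℝ) < s := by positivity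
  rw [integral_gaussianReal_eq_integral_smul hs]
  have h1 : ∀ y : ℝ, gaussianPDFReal 0 s y • Real.exp (θ * (y ^ 2 - s))
      = ((√(2 * Real.pi * s))⁻¹ * Real.exp (-(θ * s))) *
        Real.exp (-((1 - 2 * (θ * s)) / (2 * s)) * y ^ 2) := by
    intro y
    rw [gaussianPDFReal, smul_eq_mul, mul_assoc (√(2 * Real.pi * s))⁻¹ (Real.exp _) (Real.exp _),
      mul_assoc (√(2 * Real.pi * s))⁻¹ (Real.exp _) (Real.exp _), ← Real.exp_add, ← Real.exp_add]
    congr 2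
    field_simp
    ring
  simp_rw [h1]
  rw [integral_const_mul, integral_gaussian]
  have h2 : Real.pi / ((1 - 2 * (θ * s)) / (2 * s)) = (2 * Real.pi * s) / (1 - 2 * (θ * s)) := by
    have : (1 - 2 * (θ * s)) ≠ 0 := by linarith
    field_simp
  have h3 : √(2 * Real.pi * s) ≠ 0 := by positivity
  rw [h2, Real.sqrt_div (by positivity)]
  field_simp

/-- The exact value is `exp(-w/2) / √(1 - w)` with `w = 2θs`, and `-log(1 - w) ≤ w + 2w²` cancels
the linear term. Positivity later serves to prove integrability. -/
lemma integral_exp_mul_sq_gaussianReal_le {s : NNReal} {θ : ℝ} (h : |θ * s| ≤ 1 / 4) :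
    0 < ∫ y, Real.exp (θ * (y ^ 2 - s)) ∂gaussianReal 0 s ∧
    ∫ y, Real.exp (θ * (y ^ 2 - s)) ∂gaussianReal 0 s ≤ Real.exp (4 * (θ * s) ^ 2) := by
  by_cases hs : s = 0
  · subst hs
    simp
  have hu := abs_le.1 h
  have hpos : 0 < 1 - 2 * (θ * s) := by linarith
  rw [integral_exp_mul_sq_gaussianReal hs (by linarith)]
  refine ⟨by positivity, ?_⟩
  have h1 := neg_log_one_sub_le (w := 2 * (θ * s)) (by
    rw [abs_mul, abs_of_pos (two_pos : (0 : ℝ) < 2)]; linarith)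
  have h2 : √(1 - 2 * (θ * s)) = Real.exp (Real.log (1 - 2 * (θ * s)) / 2) := by
    rw [Real.sqrt_eq_rpow, Real.rpow_def_of_pos hpos]
    congr 1
    ring
  rw [h2, ← Real.exp_sub, Real.exp_le_exp]
  linarith

variable {Ω : Type*} [MeasurableSpace Ω] {P : Measure Ω}

lemma measure_sum_sq_sub_ge_le [IsProbabilityMeasure P] {n : ℕ} {Y : Fin n → Ω → ℝ} {s : NNReal}
    (hY : iIndepFun Y P) (hlaw : ∀ i, HasLaw (Y i) (gaussianReal 0 s) P) {κ t : ℝ}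
    (hκ : 0 < κ) (hs : s ≤ κ) (ht : 0 ≤ t) (ht2 : t ≤ 2) :
    P.real {ω | n * (κ * t) ≤ |∑ i, (Y i ω ^ 2 - s)|} ≤ 2 * Real.exp (-(n * t ^ 2 / 16)) := by
  set Z : Fin n → Ω → ℝ := fun i ω => Y i ω ^ 2 - s with hZ
  have hZm : ∀ i, AEMeasurable (Z i) P := fun i => ((hlaw i).aemeasurable.pow_const 2).sub_const _
  have hZi : iIndepFun Z P :=
    hY.comp (fun _ y => y ^ 2 - (s : ℝ)) (fun _ => by fun_prop)
  have hmgf : ∀ θ i, mgf (Z i) P θ = ∫ y, Real.exp (θ * (y ^ 2 - s)) ∂gaussianReal 0 s := by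
    intro θ i
    rw [mgf, ← (hlaw i).integral_comp (by fun_prop)]
    rfl
  have hsum : ∀ θ : ℝ, |θ * s| ≤ 1 / 4 → 0 < mgf (∑ i, Z i) P θ ∧
      mgf (∑ i, Z i) P θ ≤ Real.exp (4 * (θ * s) ^ 2) ^ n := by
    intro θ hθ
    have := integral_exp_mul_sq_gaussianReal_le hθ
    rw [hZi.mgf_sum₀ hZm]
    simp only [hmgf, Finset.prod_const, Finset.card_univ, Fintype.card_fin]
    exact ⟨pow_pos this.1 n, pow_le_pow_left₀ this.1.le this.2 n⟩
  have hint : ∀ θ : ℝ, |θ * s| ≤ 1 / 4 →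
      Integrable (fun ω => Real.exp (θ * (∑ i, Z i) ω)) P := fun θ hθ =>
    -- The integral of a non-integrable function is `0` by convention, so a positive value entails
    -- integrability.
    Integrable.of_integral_ne_zero (hsum θ hθ).1.ne'
  -- This choice gives the exponent `-n t²/8 + n t²/16`; `t ≤ 2` keeps `θ * s` within `1/4`.
  set θ := t / (8 * κ) with hθ
  have hθ0 : 0 ≤ θ := by positivity
  have hθs : θ * s ≤ t / 8 := by
    calc θ * s ≤ θ * κ := mul_le_mul_of_nonneg_left hs hθ0
      _ = t / 8 := by rw [hθ]; field_simp
  have hθs0 : 0 ≤ θ * s := by positivity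
  have hθ1 : |θ * s| ≤ 1 / 4 := by rw [abs_of_nonneg hθs0]; linarith
  have hθ2 : |-θ * s| ≤ 1 / 4 := by rwa [neg_mul, abs_neg]
  have hfinal : Real.exp (-(n * t ^ 2 / 8)) * Real.exp (4 * (θ * s) ^ 2) ^ n
      ≤ Real.exp (-(n * t ^ 2 / 16)) := by
    rw [← Real.exp_nat_mul, ← Real.exp_add, Real.exp_le_exp]
    have h1 : (θ * s) ^ 2 ≤ (t / 8) ^ 2 := pow_le_pow_left₀ hθs0 hθs 2
    have h2 : (n : ℝ) * (4 * (θ * s) ^ 2) ≤ n * (4 * (t / 8) ^ 2) := by gcongr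
    linarith
  have hexp : -θ * (n * (κ * t)) = -(n * t ^ 2 / 8) := by rw [hθ]; field_simp
  have hup := measure_ge_le_exp_mul_mgf (X := ∑ i, Z i) (n * (κ * t)) hθ0 (hint θ hθ1)
  have hlo := measure_le_le_exp_mul_mgf (X := ∑ i, Z i) (-(n * (κ * t)))
    (neg_nonpos.2 hθ0) (hint (-θ) hθ2)
  rw [hexp] at hup
  rw [show -(-θ) * -(n * (κ * t)) = -θ * (n * (κ * t)) by ring, hexp] at hlo
  have hup' := hup.trans ((mul_le_mul_of_nonneg_left (hsum θ hθ1).2 (Real.exp_pos _).le).trans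
    hfinal)
  have hfinal' := hfinal
  rw [← neg_sq (θ * s), ← neg_mul] at hfinal'
  have hlo' := hlo.trans ((mul_le_mul_of_nonneg_left (hsum (-θ) hθ2).2 (Real.exp_pos _).le).trans
    hfinal')
  have hsub : {ω | n * (κ * t) ≤ |∑ i, (Y i ω ^ 2 - s)|} ⊆
      {ω | n * (κ * t) ≤ (∑ i, Z i) ω} ∪ {ω | (∑ i, Z i) ω ≤ -(n * (κ * t))} := by
    intro ω hω
    have hω' : n * (κ * t) ≤ |∑ i, (Y i ω ^ 2 - s)| := hω
    have hval : (∑ i, Z i) ω = ∑ i, (Y i ω ^ 2 - s) := by simp [hZ]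
    rcases le_abs.1 hω' with h | h
    · left; rw [Set.mem_ofPred_eq, hval]; exact h
    · right; rw [Set.mem_ofPred_eq, hval]; linarith
  calc _ ≤ _ := measureReal_mono hsub
    _ ≤ _ := measureReal_union_le _ _
    _ ≤ _ := by linarith

variable {p n : ℕ}

lemma sampleCov_transpose (x : Fin n → EuclideanSpace ℝ (Fin p)) :
    (sampleCov x)ᵀ = sampleCov x := by
  simp [sampleCov, Matrix.transpose_sum, Matrix.transpose_vecMulVec]

lemma inner_sampleCov (x : Fin n → EuclideanSpace ℝ (Fin p)) (v : EuclideanSpace ℝ (Fin p)) :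
    inner ℝ v (Matrix.toEuclideanCLM (𝕜 := ℝ) (sampleCov x) v)
      = 1 / (n : ℝ) * ∑ i, inner ℝ v (x i) ^ 2 := by
  have h1 : ∀ i, inner ℝ v (x i) = v.ofLp ⬝ᵥ (x i).ofLp := fun i => by
    rw [real_inner_comm]
    simp [PiLp.inner_apply, dotProduct]
  rw [Matrix.inner_toEuclideanCLM, sampleCov, Matrix.smul_mulVec, dotProduct_smul, smul_eq_mul,
    Matrix.sum_mulVec, dotProduct_sum]
  congr 1
  refine Finset.sum_congr rfl fun i _ => ?_
  rw [h1, Matrix.vecMulVec_mulVec, dotProduct_comm (x i).ofLp v.ofLp]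
  simp [sq]

/-- Concentration of the sample covariance matrix in spectral norm. -/
lemma exists_event_sampleCov [IsProbabilityMeasure P] {Sig : Matrix (Fin p) (Fin p) ℝ}
    (hSig : Sig.PosSemidef) (hSig0 : Sig ≠ 0) (hn : 0 < n)
    {ν : Measure (EuclideanSpace ℝ (Fin p))}
    (hν : ∀ v : EuclideanSpace ℝ (Fin p),
      ν.map (fun x => inner ℝ v x) = gaussianReal 0 (v ⬝ᵥ Sig *ᵥ v).toNNReal)
    {X : Fin n → Ω → EuclideanSpace ℝ (Fin p)} (hX : iIndepFun X P) (hlaw : ∀ i, HasLaw (X i) ν P)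
    {t : ℝ} (ht : 0 ≤ t) (ht2 : t ≤ 2) :
    ∃ E : Set Ω, MeasurableSet E ∧ 1 - 5 ^ p * (2 * Real.exp (-(n * t ^ 2 / 16))) ≤ P.real E ∧
      ∀ ω ∈ E, spectralNorm (sampleCov (fun i => X i ω) - Sig) ≤ 32 * (spectralNorm Sig * t) := by
  have hsym : Sigᵀ = Sig := by
    have := hSig.1
    rwa [Matrix.IsHermitian, Matrix.conjTranspose_eq_transpose_of_trivial] at this
  set κ := spectralNorm Sig with hκ
  have hκ0 : 0 < κ := by
    open scoped Matrix.Norms.L2Operator in exact norm_pos_iff.2 hSig0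
  obtain ⟨N, hcard, hN, hnet⟩ := exists_sphere_net p
  set B : EuclideanSpace ℝ (Fin p) → Set Ω := fun v =>
    {ω | n * (κ * t) ≤ |∑ i, (inner ℝ v (X i ω) ^ 2 - (v ⬝ᵥ Sig *ᵥ v).toNNReal)|} with hB
  have hs0 : ∀ v : EuclideanSpace ℝ (Fin p), 0 ≤ v ⬝ᵥ Sig *ᵥ v := fun v =>
    hSig.dotProduct_mulVec_nonneg v.ofLp
  have hBv : ∀ v ∈ N, P.real (B v) ≤ 2 * Real.exp (-(n * t ^ 2 / 16)) := by
    intro v hv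
    refine measure_sum_sq_sub_ge_le (Y := fun i ω => inner ℝ v (X i ω))
      (hX.comp (fun _ x => inner ℝ v x) fun _ => by fun_prop) (fun i => ⟨?_, ?_⟩) hκ0 ?_ ht ht2
    · exact (by fun_prop : Measurable fun x : EuclideanSpace ℝ (Fin p) =>
        (inner ℝ v x : ℝ)).comp_aemeasurable (hlaw i).aemeasurable
    · rw [← hν v, ← (hlaw i).map_eq, AEMeasurable.map_map_of_aemeasurable (by fun_prop)
        (hlaw i).aemeasurable]
      rfl
    · rw [Real.coe_toNNReal _ (hs0 v), ← Matrix.inner_toEuclideanCLM]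
      refine (real_inner_le_norm _ _).trans ?_
      rw [hN v hv, one_mul]
      refine (ContinuousLinearMap.le_opNorm _ _).trans ?_
      rw [hN v hv, mul_one, toEuclideanCLM_norm_eq]
  set bad : Set Ω := ⋃ v ∈ N, B v with hbad
  have hPbad : P.real bad ≤ 5 ^ p * (2 * Real.exp (-(n * t ^ 2 / 16))) := by
    refine (measureReal_biUnion_finset_le N B).trans ((Finset.sum_le_sum hBv).trans ?_)
    rw [Finset.sum_const, nsmul_eq_mul]
    gcongr
    exact_mod_cast hcard
  -- The observations are only almost everywhere measurable, so `bad` is replaced by a measurable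
  -- superset of equal measure.
  refine ⟨(toMeasurable P bad)ᶜ, (measurableSet_toMeasurable P bad).compl, ?_, fun ω hω => ?_⟩
  · rw [probReal_compl_eq_one_sub (measurableSet_toMeasurable P bad)]
    have : P.real (toMeasurable P bad) = P.real bad := by
      rw [measureReal_def, measure_toMeasurable, ← measureReal_def]
    linarith
  · have hωb : ω ∉ bad := fun h => hω (subset_toMeasurable P bad h)
    refine spectralNorm_le_of_net (by rw [Matrix.transpose_sub, hsym, sampleCov_transpose]) hN hnet
      (by positivity) fun v hv => ?_
    have hωv : ω ∉ B v := fun h => hωb (Set.mem_biUnion hv h)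
    have h1 : |∑ i, (inner ℝ v (X i ω) ^ 2 - (v ⬝ᵥ Sig *ᵥ v).toNNReal)| < n * (κ * t) :=
      not_le.1 hωv
    rw [Real.coe_toNNReal _ (hs0 v), Finset.sum_sub_distrib, Finset.sum_const, Finset.card_univ,
      Fintype.card_fin, nsmul_eq_mul] at h1
    have hn' : (0 : ℝ) < n := by exact_mod_cast hn
    rw [map_sub, sub_apply, inner_sub_right, inner_sampleCov,
      Matrix.inner_toEuclideanCLM]
    have h2 : 1 / (n : ℝ) * ∑ i, inner ℝ v (X i ω) ^ 2 - v ⬝ᵥ Sig *ᵥ v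
        = 1 / n * (∑ i, inner ℝ v (X i ω) ^ 2 - n * (v ⬝ᵥ Sig *ᵥ v)) := by
      field_simp
    rw [h2, abs_mul, abs_of_pos (by positivity), one_div, inv_mul_le_iff₀ hn']
    exact h1.le

end Concentration

/-! ### Deterministic support recovery and numerical bounds. -/

section Recovery

variable {p : ℕ}

lemma mem_vecSupport {M : Matrix (Fin p) (Fin p) ℝ} {q : Fin p × Fin p} :
    q ∈ vecSupport M ↔ M.vec q ≠ 0 := by
  simp only [vecSupport, Finset.mem_filter, Finset.mem_univ, true_and]

lemma objective_eq_lassoObj {T : Matrix (Fin p) (Fin p) ℝ} (hT : Tᵀ = T)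
    (C : Matrix (Fin p) (Fin p) ℝ) (lam : ℝ) (N : Matrix (Fin p) (Fin p) ℝ) :
    objective T C lam N = lassoObj (lyapMatrix T) C.vec lam N.vec := by
  rw [objective, lassoObj, l1Norm, frobNorm, EuclideanSpace.real_norm_sq_eq, lyapMatrix_mulVec_vec,
    hT, ← Matrix.vec_add, dotProduct]
  simp only [sq]

lemma sign_eq_of_abs_sub_lt {a b : ℝ} (h : |a - b| < |b|) :
    SignType.sign a = SignType.sign b := by
  have h1 := abs_lt.1 h
  rcases lt_trichotomy b 0 with hb | hb | hb
  · rw [abs_of_neg hb] at h1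
    rw [sign_neg hb, sign_neg (by linarith)]
  · simp [hb] at h
    exact absurd h (not_lt.2 (abs_nonneg a))
  · rw [abs_of_pos hb] at h1
    rw [sign_pos hb, sign_pos (by linarith)]

/-- Support recovery for any symmetric matrix `T` that is close to the equilibrium covariance. -/
lemma recovery_of_spectralNorm_le {M C Sig T : Matrix (Fin p) (Fin p) ℝ}
    (hM0 : (vecSupport M).Nonempty) (hSig : Sigᵀ = Sig) (hT : Tᵀ = T)
    (hL : M * Sig + Sig * Mᵀ + C = 0)
    {α : ℝ} (hα : 0 < α) (hα1 : α ≤ 1)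
    (hunit : IsUnit (blockSS (gram Sig) (vecSupport M)))
    (hirr : rowSumNorm (blockScS (gram Sig) (vecSupport M) *
      (blockSS (gram Sig) (vecSupport M))⁻¹) < 1 - α)
    {δ eps lam : ℝ} (hδ : spectralNorm (T - Sig) ≤ δ) (hδ1 : δ ≤ 1)
    (heps : √((vecSupport M).card : ℝ) * (δ * (4 + 8 * spectralNorm Sig)) ≤ eps)
    (hsmall : cGamma M Sig * eps < α / 6)
    (hlam : 3 * (2 - α) * (eps * maxNorm M) < α * lam) :
    ∃ Mhat : Matrix (Fin p) (Fin p) ℝ, IsMinimizer T C lam Mhat ∧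
      (∀ N, IsMinimizer T C lam N → N = Mhat) ∧ vecSupport Mhat ⊆ vecSupport M ∧
      maxNorm (Mhat - M) < 2 * cGamma M Sig / (2 - α) * lam ∧
      ((∀ q ∈ vecSupport M, 2 * cGamma M Sig / (2 - α) * lam < |M.vec q|) →
        vecSupport Mhat = vecSupport M ∧
        ∀ q ∈ vecSupport M, SignType.sign (Mhat.vec q) = SignType.sign (M.vec q)) := by
  set S := vecSupport M with hS
  have hmax0 : 0 ≤ maxNorm M := norm_nonneg _
  have heps0 : 0 ≤ eps := by
    have := spectralNorm_nonneg Sig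
    have := (spectralNorm_nonneg (T - Sig)).trans hδ
    exact le_trans (by positivity) heps
  have hlam0 : 0 < lam := by
    have h1 : 0 ≤ 3 * (2 - α) * (eps * maxNorm M) := by
      have : 0 ≤ 2 - α := by linarith
      positivity
    exact pos_of_mul_pos_right (h1.trans_lt hlam) hα.le
  have hD : ∀ a, ∑ q ∈ S, |(gram T - gram Sig) a q| ≤ eps := fun a =>
    (sum_abs_gram_sub_le hδ hδ1 S a).trans heps
  have hr : ∀ q, |lassoGrad (lyapMatrix T) C.vec M.vec q| ≤ eps * maxNorm M := fun q =>
    (abs_lassoGrad_le hSig hL hδ hδ1 q).trans (mul_le_mul_of_nonneg_right heps hmax0)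
  obtain ⟨x, hx, hxmin⟩ := exists_minimizer_of_support (lyapMatrix T) C.vec hlam0 S
  obtain ⟨Mhat, rfl⟩ := Matrix.vec_bijective.2 x
  have hkkt : ∀ q ∈ S, _ := fun q hq => kkt_of_minimizer _ _ hlam0.le S hx hxmin hq
  have hu : ∀ q, q ∉ S → (Mhat.vec - M.vec) q = 0 := fun q hq => by
    have h1 : M.vec q = 0 := by
      by_contra h
      exact hq (mem_vecSupport.2 h)
    rw [Pi.sub_apply, hx q hq, h1, sub_zero]
  obtain ⟨hbound, hdual⟩ := witness_bounds hunit hM0 hα hα1 hirr hD heps0 hsmall hu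
    (lassoGrad_sub (lyapMatrix T) C.vec Mhat.vec M.vec) (fun q hq => (hkkt q hq).1) hr hlam
  have hopt := lassoObj_le_of_kkt (lyapMatrix T) C.vec lam S hx hkkt hdual
    (fun h hh h0 => eq_zero_of_mulVec_eq_zero (H := gram T) hunit hD heps0
      (hsmall.trans (by linarith)) hh (by rw [gram, ← Matrix.mulVec_mulVec, h0, Matrix.mulVec_zero]))
  have hsub : vecSupport Mhat ⊆ S := fun q hq => by
    by_contra h
    exact mem_vecSupport.1 hq (hx q h)
  have hnorm : maxNorm (Mhat - M) < 2 * cGamma M Sig / (2 - α) * lam := by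
    rw [maxNorm, Matrix.vec_sub]
    exact hbound
  refine ⟨Mhat, fun N => ?_, fun N hN => ?_, hsub, hnorm, fun hmin => ?_⟩
  · rw [objective_eq_lassoObj hT, objective_eq_lassoObj hT]
    exact (hopt _).1
  · have h1 := hN Mhat
    rw [objective_eq_lassoObj hT, objective_eq_lassoObj hT] at h1
    exact Matrix.vec_inj.1 ((hopt _).2 h1)
  · have hsign : ∀ q ∈ S, SignType.sign (Mhat.vec q) = SignType.sign (M.vec q) := fun q hq =>
      sign_eq_of_abs_sub_lt (((norm_le_pi_norm (Mhat.vec - M.vec) q).trans_lt hbound).trans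
        (hmin q hq))
    refine ⟨hsub.antisymm fun q hq => mem_vecSupport.2 fun h => ?_, hsign⟩
    have h1 := hsign q hq
    rw [h, sign_zero] at h1
    exact mem_vecSupport.1 hq (sign_eq_zero_iff.1 h1.symm)

/-- The zero matrix has eigenvalue `0`, which stability excludes. -/
lemma IsStable.vecSupport_nonempty {M : Matrix (Fin p) (Fin p) ℝ} (hM : IsStable M) (hp : 0 < p) :
    (vecSupport M).Nonempty := by
  have : Nonempty (Fin p) := ⟨⟨0, hp⟩⟩
  by_contra h
  have hM0 : M = 0 := by
    rw [← Matrix.vec_eq_zero_iff]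
    ext q
    by_contra hq
    exact h ⟨q, mem_vecSupport.2 hq⟩
  have h1 := hM 0 (by
    have h2 : M.map (algebraMap ℝ ℂ) = 0 := by rw [hM0]; ext; simp
    rw [h2, spectrum.zero_mem_iff]
    exact not_isUnit_zero)
  simp at h1

/-- Since `5 ≤ exp 2` and `τ > 1`, the net size costs only `2p ≤ 2τp` of the exponent `4τp`. -/
lemma five_pow_mul_exp_le (p : ℕ) {τ : ℝ} (hτ : 1 < τ) :
    5 ^ p * (2 * Real.exp (-(4 * (τ * p)))) ≤ 2 * Real.exp (-(τ * p)) := by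
  have h5 : (5 : ℝ) ≤ Real.exp 2 := by
    have h1 := Real.exp_one_gt_d9
    have h2 : Real.exp 2 = Real.exp 1 ^ 2 := by rw [← Real.exp_nat_mul]; norm_num
    rw [h2]
    nlinarith
  have h6 : (5 : ℝ) ^ p ≤ Real.exp (p * 2) := by
    rw [Real.exp_nat_mul]
    exact pow_le_pow_left₀ (by norm_num) h5 p
  calc _ ≤ Real.exp (p * 2) * (2 * Real.exp (-(4 * (τ * p)))) := by gcongr
    _ = 2 * Real.exp (p * 2 + -(4 * (τ * p))) := by rw [Real.exp_add]; ring
    _ ≤ _ := by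
        gcongr
        have : (p : ℝ) ≤ τ * p := le_mul_of_one_le_left p.cast_nonneg hτ.le
        linarith

end Recovery

end LyapunovLasso

/-! ### Choice of constants and assembly. -/

theorem theorem1 :
    ∃ c₀ c₂ c₃ : ℝ, 0 < c₀ ∧ 0 < c₂ ∧ 0 < c₃ ∧
      ∀ (p n : ℕ), 0 < p →
      -- the Ornstein-Uhlenbeck model and its equilibrium covariance matrix
      ∀ M C Sig : Matrix (Fin p) (Fin p) ℝ,
        LyapunovLasso.IsStable M → C.PosDef → M * Sig + Sig * Mᵀ + C = 0 →
      -- the data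
      ∀ (Ω : Type*) [MeasurableSpace Ω] (P : Measure Ω) [IsProbabilityMeasure P]
        (ν : Measure (EuclideanSpace ℝ (Fin p))) (X : Fin n → Ω → EuclideanSpace ℝ (Fin p)),
        LyapunovLasso.IsOUEquilibrium M C ν → iIndepFun X P → (∀ i, HasLaw (X i) ν P) →
      -- identifiability and irrepresentability
      ∀ α : ℝ, 0 < α → α ≤ 1 →
        IsUnit (LyapunovLasso.blockSS (LyapunovLasso.gram Sig) (LyapunovLasso.vecSupport M)) →
        LyapunovLasso.rowSumNorm
            (LyapunovLasso.blockScS (LyapunovLasso.gram Sig) (LyapunovLasso.vecSupport M) *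
              (LyapunovLasso.blockSS (LyapunovLasso.gram Sig)
                (LyapunovLasso.vecSupport M))⁻¹) < 1 - α →
      ∀ c₁ τ₁ lam d cΓ ct : ℝ, c₀ ≤ c₁ → 1 < τ₁ →
        d = ((LyapunovLasso.vecSupport M).card : ℝ) →
        cΓ = LyapunovLasso.cGamma M Sig →
        ct = LyapunovLasso.cTilde c₁ c₃ (LyapunovLasso.spectralNorm Sig)
          (LyapunovLasso.frobNorm C) →
        τ₁ * ct * d * p * max ((6 / α * cΓ) ^ 2) (1 / 4) < n →
        3 * LyapunovLasso.maxNorm M * (2 - α) / α * √(τ₁ * ct * d * p / n) < lam →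
      -- the event of probability at least `1 - c₂ exp (-τ₁ p)`
      ∃ E : Set Ω, MeasurableSet E ∧ 1 - c₂ * Real.exp (-(τ₁ * p)) ≤ P.real E ∧
        ∀ ω ∈ E, ∃ Mhat : Matrix (Fin p) (Fin p) ℝ,
          -- existence and uniqueness of the minimizer
          LyapunovLasso.IsMinimizer (LyapunovLasso.sampleCov fun i => X i ω) C lam Mhat ∧
          (∀ N : Matrix (Fin p) (Fin p) ℝ,
            LyapunovLasso.IsMinimizer (LyapunovLasso.sampleCov fun i => X i ω) C lam N →
              N = Mhat) ∧
          -- support inclusion and error bound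
          LyapunovLasso.vecSupport Mhat ⊆ LyapunovLasso.vecSupport M ∧
          LyapunovLasso.maxNorm (Mhat - M) < 2 * cΓ / (2 - α) * lam ∧
          -- recovery of support and signs under the minimal signal condition
          ((∀ q ∈ LyapunovLasso.vecSupport M, 2 * cΓ / (2 - α) * lam < |M.vec q|) →
            LyapunovLasso.vecSupport Mhat = LyapunovLasso.vecSupport M ∧
            ∀ q ∈ LyapunovLasso.vecSupport M,
              SignType.sign (Mhat.vec q) = SignType.sign (M.vec q)) := by
  -- `64` is forced by `(32 * 8)² = 16 * 64²`, which matches `δ²` with the second entry of `cTilde`;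
  -- `2` counts the two tails; with `c₃ = 1` the first entry is at least `64`.
  refine ⟨64, 2, 1, by norm_num, by norm_num, by norm_num, ?_⟩
  intro p n hp M C Sig hM hC hL Ω _ P _ ν X hν hX hlaw α hα hα1 hunit hirr c₁ τ lam d cΓ ct
    hc₁ hτ hd hcΓ hct hn hlam
  have hS := hM.vecSupport_nonempty hp
  have hSigPSD := LyapunovLasso.equilibriumCov_posSemidef hM hp hC hL
  have hSigT : Sigᵀ = Sig := by
    have := hSigPSD.1
    rwa [Matrix.IsHermitian, Matrix.conjTranspose_eq_transpose_of_trivial] at this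
  have hSig0 : Sig ≠ 0 := by
    rintro rfl
    have : Nonempty (Fin p) := ⟨⟨0, hp⟩⟩
    simp only [Matrix.mul_zero, Matrix.zero_mul, zero_add] at hL
    exact (hC.trace_pos).ne' (by simp [hL])
  set κ := LyapunovLasso.spectralNorm Sig with hκ
  have hκ0 : 0 ≤ κ := LyapunovLasso.spectralNorm_nonneg Sig
  have hd1 : 1 ≤ d := by
    rw [hd]
    exact_mod_cast hS.card_pos
  have hct1 : 64 ≤ ct := by
    rw [hct]
    refine le_trans ?_ ((le_max_left _ _).trans (le_max_left _ _))
    have h1 : (1 : ℝ) ≤ max 1 (κ ^ 2) := le_max_left _ _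
    have h2 : (4 : ℝ) ^ 2 ≤ (4 + 8 * κ) ^ 2 := pow_le_pow_left₀ (by norm_num) (by linarith) 2
    nlinarith
  have hct2 : 65536 * (κ ^ 2 * (4 + 8 * κ) ^ 2) ≤ ct := by
    rw [hct]
    refine le_trans ?_ ((le_max_right _ _).trans (le_max_left _ _))
    have h1 : (64 : ℝ) ^ 2 ≤ c₁ ^ 2 := pow_le_pow_left₀ (by norm_num) hc₁ 2
    have h2 : 0 ≤ κ ^ 2 * (4 + 8 * κ) ^ 2 := by positivity
    nlinarith
  have hp0 : (0 : ℝ) < p := by exact_mod_cast hp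
  have hτ0 : 0 < τ := by linarith
  have hct0 : 0 < ct := by linarith
  have hd0 : 0 < d := by linarith
  have hn0 : (0 : ℝ) < n := lt_of_le_of_lt (by positivity) hn
  set x := τ * p / n with hx
  have hx0 : 0 < x := by positivity
  have hxe : τ * ct * d * p / n = ct * d * x := by rw [hx]; ring
  have hxm : ct * d * x * max ((6 / α * cΓ) ^ 2) (1 / 4) < 1 := by
    have h1 : ct * d * x * max ((6 / α * cΓ) ^ 2) (1 / 4)
        = τ * ct * d * p * max ((6 / α * cΓ) ^ 2) (1 / 4) / n := by rw [hx]; ring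
    rw [h1, div_lt_one hn0]
    exact hn
  have hcdx0 : 0 < ct * d * x := by positivity
  have hx4 : ct * d * x < 4 := by
    have := (mul_le_mul_of_nonneg_left (le_max_right ((6 / α * cΓ) ^ 2) (1 / 4)) hcdx0.le).trans_lt
      hxm
    linarith
  have hxc : ct * d * x * (6 / α * cΓ) ^ 2 < 1 :=
    (mul_le_mul_of_nonneg_left (le_max_left ((6 / α * cΓ) ^ 2) (1 / 4)) hcdx0.le).trans_lt hxm
  have hx16 : x ≤ 1 / 16 := by
    have h1 : 64 * 1 * x ≤ ct * d * x := by gcongr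
    linarith
  rw [hxe] at hlam
  set eps := √(ct * d * x) with heps
  have heps2 : eps ^ 2 = ct * d * x := Real.sq_sqrt hcdx0.le
  have heps0 : 0 ≤ eps := Real.sqrt_nonneg _
  have hsx2 : √x ^ 2 = x := Real.sq_sqrt hx0.le
  have ht2 : 8 * √x ≤ 2 := by
    have : √x ≤ 1 / 4 := Real.sqrt_le_iff.2 ⟨by norm_num, by linarith⟩
    linarith
  -- With `t = 8√x` the tail exponent `n t²/16` is `4τp`; `x ≤ 1/16` ensures `t ≤ 2`.
  obtain ⟨E, hE, hPE, hgood⟩ := LyapunovLasso.exists_event_sampleCov hSigPSD hSig0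
    (Nat.cast_pos.1 hn0) (hν.map_inner hM hp hC hL) hX hlaw (t := 8 * √x) (by positivity) ht2
  refine ⟨E, hE, ?_, fun ω hω => ?_⟩
  · have h1 : n * (8 * √x) ^ 2 / 16 = 4 * (τ * p) := by
      rw [mul_pow, hsx2, hx]
      field_simp
      norm_num
    rw [h1] at hPE
    linarith [LyapunovLasso.five_pow_mul_exp_le p hτ]
  · set δ := 32 * (κ * (8 * √x)) with hδ
    have hδ0 : 0 ≤ δ := by positivity
    have hle : √d * (δ * (4 + 8 * κ)) ≤ eps := by
      refine le_of_sq_le_sq ?_ heps0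
      rw [heps2]
      calc (√d * (δ * (4 + 8 * κ))) ^ 2
          = √d ^ 2 * √x ^ 2 * (65536 * (κ ^ 2 * (4 + 8 * κ) ^ 2)) := by rw [hδ]; ring
        _ = d * x * (65536 * (κ ^ 2 * (4 + 8 * κ) ^ 2)) := by rw [Real.sq_sqrt hd0.le, hsx2]
        _ ≤ d * x * ct := by gcongr
        _ = ct * d * x := by ring
    -- The entry `1/4` in the sample size condition gives `eps ≤ 2`, while `4δ ≤ eps`.
    have hδ1 : δ ≤ 1 := by
      have h1 : eps ≤ 2 := by
        refine le_of_sq_le_sq ?_ (by norm_num)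
        rw [heps2]
        linarith
      have h2 : 1 * (δ * 4) ≤ √d * (δ * (4 + 8 * κ)) := by
        gcongr
        · exact Real.one_le_sqrt.2 hd1
        · linarith
      linarith
    have hcG0 : 0 ≤ cΓ := hcΓ ▸ LyapunovLasso.rowSumNorm_nonneg _
    have hsmall : cΓ * eps < α / 6 := by
      have h1 : (eps * (6 / α * cΓ)) ^ 2 < 1 ^ 2 := by rw [mul_pow, heps2]; linarith
      have h2 := lt_of_pow_lt_pow_left₀ 2 zero_le_one h1
      have h3 : eps * (6 / α * cΓ) = cΓ * eps * 6 / α := by ring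
      rw [h3, div_lt_one hα] at h2
      linarith
    have hlam' : 3 * (2 - α) * (eps * LyapunovLasso.maxNorm M) < α * lam := by
      have h1 := mul_lt_mul_of_pos_left hlam hα
      have h2 : α * (3 * LyapunovLasso.maxNorm M * (2 - α) / α * eps)
          = 3 * (2 - α) * (eps * LyapunovLasso.maxNorm M) := by field_simp
      linarith
    rw [hd] at hle
    subst hcΓ
    exact LyapunovLasso.recovery_of_spectralNorm_le hS hSigT (LyapunovLasso.sampleCov_transpose _)
      hL hα hα1 hunit hirr (hgood ω hω) hδ1 hle hsmall hlam'
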